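/- Notation. Let $\kappa>0$. For $s\in\mathbb R$ let $v(s)>0$ and $k(s)\in(-\kappa,\kappa)$ be the unique solutions of $v-v^{-1}=s$ and $(-\kappa-k)^{-1}+(\kappa-k)^{-1}=s$. Let $\mathcal L_{-\kappa}^{+\kappa}(I,\cdot)$ be the set of curves $\gamma=\Phi e_1\colon[0,1]\to\mathbb S^2$, where $(\hat v,\hat w)\in L^2[0,1]\times L^2[0,1]$ and $\Phi\colon[0,1]\to \mathrm{SO}_3$ is the absolutely continuous solution of $$\dot\Phi=\Phi\begin{pmatrix}0&-v&0\\ v&0&-w\\ 0&w&0\end{pmatrix},\qquad \Phi(0)=I,\qquad v=v(\hat v(t)),\quad w=v(\hat v(t))\,k(\hat w(t)).$$ Its topology is that of $L^2[0,1]\times L^2[0,1]$, via $\gamma\leftrightarrow(\hat v,\hat w)$. (So $\gamma$ has frame $\Phi=(\gamma,\mathbf t,\mathbf n)$ with unit tangent $\mathbf t=\Phi e_2$ and unit normal $\mathbf n=\Phi e_3=\gamma\times\mathbf t$, and its geodesic curvature lies in $(-\kappa,\kappa)$ almost everywhere.) Let $\mathcal L_{-\kappa}^{+\kappa}(I)$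 be the subspace of those curves with $\Phi(1)=I$; extend such $\gamma$ and $\Phi$ to $\mathbb R$ with period $1$. Let $\mathcal A\subset\mathcal L_{-\kappa}^{+\kappa}(I)$ be the subspace of the curves with $\gamma(t+\frac12)=-\gamma(t)$ for all $t\in\mathbb R$. For $r>0$, the band of half-width $r$ of $\gamma$ is the map $B_\gamma\colon\mathbb R\times[-r,r]\to\mathbb S^2$, $B_\gamma(t,\theta)=\cos\theta\,\gamma(t)+\sin\theta\,\mathbf n(t)$; it is called simple if it is injective on $[0,1)\times[-r,r]$. The (full) regular band of $\gamma$ is the one of half-width $\rho=\operatorname{arccot}\kappa\in(0,\frac\pi2)$. Finally let $\sigma_m(t)=(\cos((2m+1)2\pi t),\sin((2m+1)2\pi t),0)$. Proposition. Let $0<\kappa\le\sqrt3$, so that $\frac\pi6\le\rho$, and let $r\in[\frac\pi6,\rho]$ (in particular $r=\frac\pi6$, or $r=\rho$). Let $\mathcal A_0$ be the set of all $\gamma\in\mathcal A$ whose band of half-width $r$ is simple. Then $\sigma_0\in\mathcal A_0$, $\sigma_2\in\mathcal A$ but $\sigma_2\notin\mathcal A_0$, and $\mathcal A_0$ is both open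 and closed in $\mathcal A$. -/

import Mathlib

open MeasureTheory Set Real

namespace BandCurves

noncomputable section

/-- The diffeomorphism `h : (0, ∞) → ℝ`, `h t = t - t⁻¹`, used as a chart for the speed. -/
def speedChart (t : ℝ) : ℝ := t - t⁻¹

/-- The inverse `ℝ → (0, ∞)` of `speedChart`, in closed form. -/
def speedOf (s : ℝ) : ℝ := (s + √(s ^ 2 + 4)) / 2

/-- The diffeomorphism `(κ₁, κ₂) → ℝ`, `t ↦ (κ₁ - t)⁻¹ + (κ₂ - t)⁻¹`, used as a chart for the
geodesic curvature. -/
def curvatureChart (κ₁ κ₂ t : ℝ) : ℝ := (κ₁ - t)⁻¹ + (κ₂ - t)⁻¹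

/-- The inverse `ℝ → (κ₁, κ₂)` of `curvatureChart κ₁ κ₂` (for `κ₁ < κ₂`), in closed form. -/
def curvatureOf (κ₁ κ₂ s : ℝ) : ℝ :=
  (κ₁ + κ₂) / 2 + s * ((κ₂ - κ₁) / 2) ^ 2 / (1 + √(1 + (s * ((κ₂ - κ₁) / 2)) ^ 2))

theorem speedOf_pos (s : ℝ) : 0 < speedOf s := by
  have h : |s| < √(s ^ 2 + 4) := by
    rw [← Real.sqrt_sq_eq_abs]
    exact Real.sqrt_lt_sqrt (sq_nonneg s) (by linarith)
  have := neg_abs_le s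
  unfold speedOf
  linarith

theorem speedChart_speedOf (s : ℝ) : speedChart (speedOf s) = s := by
  have hp := speedOf_pos s
  have hq : speedOf s ^ 2 - s * speedOf s - 1 = 0 := by
    have h : √(s ^ 2 + 4) ^ 2 = s ^ 2 + 4 := Real.sq_sqrt (by positivity)
    unfold speedOf
    linear_combination h / 4
  unfold speedChart
  field_simp
  linarith

theorem speedOf_speedChart {t : ℝ} (ht : 0 < t) : speedOf (speedChart t) = t := by
  have h : speedChart t ^ 2 + 4 = (t + t⁻¹) ^ 2 := by
    unfold speedChart
    field_simp
    ring
  unfold speedOf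
  rw [h, Real.sqrt_sq (by positivity)]
  unfold speedChart
  ring

theorem curvatureOf_mem {κ₁ κ₂ : ℝ} (h : κ₁ < κ₂) (s : ℝ) :
    curvatureOf κ₁ κ₂ s ∈ Ioo κ₁ κ₂ := by
  obtain ⟨d, hd⟩ : ∃ d, d = (κ₂ - κ₁) / 2 := ⟨_, rfl⟩
  have hd0 : 0 < d := by rw [hd]; linarith
  have h1 : |s * d| < 1 + √(1 + (s * d) ^ 2) := by
    have : |s * d| ≤ √(1 + (s * d) ^ 2) := by
      rw [← Real.sqrt_sq_eq_abs]
      exact Real.sqrt_le_sqrt (by linarith)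
    linarith
  have h2 : |s * d ^ 2 / (1 + √(1 + (s * d) ^ 2))| < d := by
    have hp : 0 < 1 + √(1 + (s * d) ^ 2) := by positivity
    rw [abs_div, abs_of_pos hp, div_lt_iff₀ hp]
    have : s * d ^ 2 = s * d * d := by ring
    rw [this, abs_mul, abs_of_pos hd0, mul_comm]
    exact mul_lt_mul_of_pos_left h1 hd0
  have h3 := abs_lt.1 h2
  unfold curvatureOf
  rw [← hd]
  constructor <;> linarith [h3.1, h3.2]

theorem curvatureChart_injOn (κ₁ κ₂ : ℝ) : InjOn (curvatureChart κ₁ κ₂) (Ioo κ₁ κ₂) := by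
  have key : ∀ x ∈ Ioo κ₁ κ₂, ∀ y ∈ Ioo κ₁ κ₂, x < y →
      curvatureChart κ₁ κ₂ x < curvatureChart κ₁ κ₂ y := by
    rintro x ⟨hx1, hx2⟩ y ⟨hy1, hy2⟩ hxy
    have e1 : (κ₁ - x)⁻¹ < (κ₁ - y)⁻¹ := by
      rw [inv_lt_inv_of_neg (by linarith) (by linarith)]
      linarith
    have e2 : (κ₂ - x)⁻¹ < (κ₂ - y)⁻¹ := by
      rw [inv_lt_inv₀ (by linarith) (by linarith)]
      linarith
    unfold curvatureChart
    linarith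
  intro x hx y hy hxy
  rcases lt_trichotomy x y with h | h | h
  · exact absurd hxy (key x hx y hy h).ne
  · exact h
  · exact absurd hxy (key y hy x hx h).ne'

theorem curvatureChart_curvatureOf {κ₁ κ₂ : ℝ} (h : κ₁ < κ₂) (s : ℝ) :
    curvatureChart κ₁ κ₂ (curvatureOf κ₁ κ₂ s) = s := by
  obtain ⟨hm1, hm2⟩ := curvatureOf_mem h s
  obtain ⟨d, hd⟩ : ∃ d, d = (κ₂ - κ₁) / 2 := ⟨_, rfl⟩
  obtain ⟨R, hR⟩ : ∃ R, R = √(1 + (s * d) ^ 2) := ⟨_, rfl⟩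
  have hR2 : R ^ 2 = 1 + (s * d) ^ 2 := by rw [hR]; exact Real.sq_sqrt (by positivity)
  have hR0 : 0 < 1 + R := by rw [hR]; positivity
  obtain ⟨u, hu⟩ : ∃ u, u = s * d ^ 2 / (1 + R) := ⟨_, rfl⟩
  have hc : curvatureOf κ₁ κ₂ s = (κ₁ + κ₂) / 2 + u := by
    unfold curvatureOf
    rw [← hd, ← hR, ← hu]
  have hq : s * u ^ 2 + 2 * u - s * d ^ 2 = 0 := by
    have hu' : u * (1 + R) = s * d ^ 2 := by
      rw [hu]
      exact div_mul_cancel₀ _ hR0.ne'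
    have h0 : (1 + R) ^ 2 * (s * u ^ 2 + 2 * u - s * d ^ 2) = 0 := by
      linear_combination (s * (u * (1 + R) + s * d ^ 2) + 2 * (1 + R)) * hu' - s * d ^ 2 * hR2
    exact (mul_eq_zero.1 h0).resolve_left (by positivity)
  have e1 : κ₁ - curvatureOf κ₁ κ₂ s ≠ 0 := by linarith
  have e2 : κ₂ - curvatureOf κ₁ κ₂ s ≠ 0 := by linarith
  unfold curvatureChart
  field_simp
  rw [hc]
  rw [hd] at hq
  linear_combination -hq

/-- The Hilbert space `L²[0,1]`. -/
abbrev L2I : Type := Lp ℝ 2 (volume.restrict (Icc (0 : ℝ) 1))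

/-- The matrix of the linear equation `Φ' = Φ Λ` of the frame of a curve on the sphere with
speed `v` and geodesic curvature `w / v`. -/
def frameMatrix (v w : ℝ) : Matrix (Fin 3) (Fin 3) ℝ :=
  !![0, -v, 0;
     v, 0, -w;
     0, w, 0]

/-- A `(κ₁, κ₂)`-admissible curve `[0,1] → S²` with initial frame the identity. It is given by
a pair `(vhat, what)` in `L²[0,1] × L²[0,1]`; its speed is `v = speedOf vhat`, its geodesic
curvature is `curvatureOf κ₁ κ₂ what`, and its frame `Φ = (γ, t, n)` is the (unique, absolutely
continuous, `SO(3)`-valued) solution of `Φ' = Φ Λ`, `Φ 0 = 1`, written in integral form. The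
curve itself is the first column of `Φ`. -/
structure AdmissibleCurve (κ₁ κ₂ : ℝ) where
  vhat : L2I
  what : L2I
  frame : C(Icc (0 : ℝ) 1, Matrix (Fin 3) (Fin 3) ℝ)
  frame_eq : ∀ (t : Icc (0 : ℝ) 1) (i j : Fin 3),
    frame t i j = (1 : Matrix (Fin 3) (Fin 3) ℝ) i j +
      ∫ s in (0 : ℝ)..t, (IccExtend zero_le_one frame s *
        frameMatrix (speedOf (vhat s)) (speedOf (vhat s) * curvatureOf κ₁ κ₂ (what s))) i j

namespace AdmissibleCurve

variable {κ₁ κ₂ : ℝ}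

/-- The topology of the space of curves is that of `L²[0,1] × L²[0,1]`, through
`γ ↔ (vhat, what)`. -/
instance : TopologicalSpace (AdmissibleCurve κ₁ κ₂) :=
  TopologicalSpace.induced (fun γ => (γ.vhat, γ.what)) inferInstance

/-- The frame of a curve, extended to `ℝ` by `1`-periodicity (used for closed curves). -/
def periodicFrame (γ : AdmissibleCurve κ₁ κ₂) (t : ℝ) : Matrix (Fin 3) (Fin 3) ℝ :=
  γ.frame ⟨Int.fract t, Int.fract_nonneg t, (Int.fract_lt_one t).le⟩

/-- The curve `γ`, extended to `ℝ` by `1`-periodicity: the first column of the frame. -/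
def curve (γ : AdmissibleCurve κ₁ κ₂) (t : ℝ) : Fin 3 → ℝ := fun i => γ.periodicFrame t i 0

/-- The unit normal `n = γ × t`: the third column of the frame. -/
def normal (γ : AdmissibleCurve κ₁ κ₂) (t : ℝ) : Fin 3 → ℝ := fun i => γ.periodicFrame t i 2

/-- The map `(t, θ) ↦ cos θ γ(t) + sin θ n(t)` that defines the band spanned by `γ`. -/
def band (γ : AdmissibleCurve κ₁ κ₂) (p : ℝ × ℝ) : Fin 3 → ℝ :=
  cos p.2 • γ.curve p.1 + sin p.2 • γ.normal p.1

/-- The band of `γ` over `ℝ × [a, b]` is simple. -/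
def BandSimple (γ : AdmissibleCurve κ₁ κ₂) (a b : ℝ) : Prop :=
  InjOn γ.band (Ico (0 : ℝ) 1 ×ˢ Icc a b)

end AdmissibleCurve

/-- The space of `(κ₁, κ₂)`-admissible closed curves: initial and final frame the identity. -/
def closedCurves (κ₁ κ₂ : ℝ) : Set (AdmissibleCurve κ₁ κ₂) :=
  {γ | γ.frame 0 = 1 ∧ γ.frame 1 = 1}

/-- The space of closed curves with curvature in `(-κ, κ)` and `γ (t + 1/2) = -γ t`. -/
def antipodalCurves (κ : ℝ) : Set (AdmissibleCurve (-κ) κ) :=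
  {γ | γ ∈ closedCurves (-κ) κ ∧ ∀ t : ℝ, γ.curve (t + 1 / 2) = -γ.curve t}

/-- The curves of `antipodalCurves κ` whose band of half-width `r` is simple. The full regular band
of a curve with curvature in `(-κ, κ)` has half-width `r = arccot κ`; if `κ ≤ √3` it contains the
band of half-width `r = π / 6`. -/
def simpleAntipodalCurves (κ r : ℝ) : Set (AdmissibleCurve (-κ) κ) :=
  {γ | γ ∈ antipodalCurves κ ∧ γ.BandSimple (-r) r}

/-- The inverse cotangent with values in `(0, π)`. -/
def arccot (x : ℝ) : ℝ := π / 2 - arctan x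

/-- The equator traversed `2m + 1` times. -/
def sigma (m : ℕ) (t : ℝ) : Fin 3 → ℝ :=
  ![cos ((2 * m + 1) * (2 * π * t)), sin ((2 * m + 1) * (2 * π * t)), 0]

end

end BandCurves

/-!
The proof works with the height functions `f = ⟪γ, m⟫` of a closed curve `γ` with frame `(γ, t, n)`,
for unit vectors `m`. Put `c = cos r`. A point `m` of the sphere is the band point of parameters
`(τ, θ)`, `|θ| ≤ r`, exactly when `f τ ≥ c` and `τ` is a critical point of `f`. Since the geodesic
curvature is less than `κ ≤ cot r` in absolute value, `⟪t, m⟫` is strictly decreasing as long as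
`f ≥ c` (`FramedLoop.inner_T_lt_of_mem_cap`), so that `f` has one critical point on each component
of `{f ≥ c}`.

Simplicity of the closed band is an open condition (`FramedLoop.Simple.exists_stable`). Along an arc
on which the tangent `t` turns by less than a right angle, every parallel curve `band · θ` moves
strictly forward, which excludes double points that are close in time, uniformly for nearby curves
and even for `r = arccot κ` (`FramedLoop.band_ne_band`). Double points that are far apart in time
are excluded by compactness.

Non-simplicity is also an open condition. If `f > c` at two times separated by times with `f < c`
(`FramedLoop.TwoPeaks`), then the same holds for nearby curves, and the band has a double point. So
it suffices that every antipodal curve whose band is not simple has two peaks, for some `m`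
(`FramedLoop.twoPeaks_of_not_simple`). Suppose it does not. At a double point `m` of the band, a
small displacement of `m` produces two peaks, unless both times `t₁`, `t₂` satisfy `f = c` and
`γ t₁`, `γ t₂` are opposite points of the circle of centre `m` and radius `r`. The great circle
through these points is then crossed orthogonally at `t₁` and `t₂`; because `γ (t + 1/2) = -γ t`,
the number of crossings in a half period is odd, and there is a third crossing `s`
(`FramedLoop.exists_third_zero`). The caps of radius `r` that touch the curve at `γ t₁` and `γ t₂`
leave room for `±γ s` only if `r ≤ π / 6` (`FramedLoop.false_of_crossing`).

For `r = π / 6` the six points `±γ t₁`, `±γ t₂`, `±γ s` form a regular hexagon on the great circle,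
and neighbouring strands of the curve stay at distance at least `π / 3`. At height `h ≠ 0` over the
great circle, six points whose consecutive distances are at least `π / 3` do not fit, which excludes
this case as well (`FramedLoop.false_of_hexagon`). No part of the argument uses the Jordan curve
theorem: its role is taken over by the antipodal symmetry.

The topology enters only through the uniform distance of frames. For two solutions of the frame
equations `Φ' = Φ Λ`, `Ψ' = Ψ M` one has `(Φ Ψᵀ)' = Φ (Λ - M) Ψᵀ`, as `M` is antisymmetric; this
gives the orthogonality of frames and their continuous dependence on the coefficients without
Grönwall's inequality.
-/

namespace BandCurves

open Filter Topology
open scoped RealInnerProductSpace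

/-! ### Framed loops -/

/-- A closed curve `X` on the unit sphere together with its moving frame `(X, T, N)`, extended to
the line with period `1`. The frame equations `X' = v T`, `T' = v (-X + k N)`, `N' = -v k T`
(speed `v > 0`, geodesic curvature `k ∈ (-κ, κ)`) are only assumed in integrated form, tested
against a vector `m`. Completeness of the frame is encoded by Parseval's identity, so that no
basis of the ambient space has to be chosen. -/
structure FramedLoop (κ : ℝ) (E : Type*) [NormedAddCommGroup E] [InnerProductSpace ℝ E] where
  /-- the curve -/
  X : ℝ → E
  /-- its unit tangent -/
  T : ℝ → E
  /-- its unit normal -/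
  N : ℝ → E
  /-- its speed -/
  v : ℝ → ℝ
  /-- its geodesic curvature -/
  k : ℝ → ℝ
  continuous_X : Continuous X
  continuous_T : Continuous T
  continuous_N : Continuous N
  periodic_X : Function.Periodic X 1
  periodic_T : Function.Periodic T 1
  periodic_N : Function.Periodic N 1
  v_pos : ∀ t, 0 < v t
  abs_k_lt : ∀ t, |k t| < κ
  parseval : ∀ t x, ⟪X t, x⟫ ^ 2 + ⟪T t, x⟫ ^ 2 + ⟪N t, x⟫ ^ 2 = ‖x‖ ^ 2
  norm_X : ∀ t, ‖X t‖ = 1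
  norm_T : ∀ t, ‖T t‖ = 1
  norm_N : ∀ t, ‖N t‖ = 1
  inner_X_T : ∀ t, ⟪X t, T t⟫ = 0
  inner_X_N : ∀ t, ⟪X t, N t⟫ = 0
  inner_T_N : ∀ t, ⟪T t, N t⟫ = 0
  integrable_v : ∀ a b, IntervalIntegrable v volume a b
  integrable_vk : ∀ a b, IntervalIntegrable (fun t => v t * k t) volume a b
  X_sub : ∀ m a b, ⟪X b, m⟫ - ⟪X a, m⟫ = ∫ t in a..b, v t * ⟪T t, m⟫
  T_sub : ∀ m a b, ⟪T b, m⟫ - ⟪T a, m⟫ = ∫ t in a..b, v t * (-⟪X t, m⟫ + k t * ⟪N t, m⟫)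
  N_sub : ∀ m a b, ⟪N b, m⟫ - ⟪N a, m⟫ = ∫ t in a..b, v t * (-(k t * ⟪T t, m⟫))

namespace FramedLoop

variable {κ : ℝ} {E : Type*} [NormedAddCommGroup E] [InnerProductSpace ℝ E] (L : FramedLoop κ E)

/-- The point of the band at signed distance `θ` from `X t`. -/
noncomputable def band (t θ : ℝ) : E := cos θ • L.X t + sin θ • L.N t

/-- The band of half-width `r` is simple. -/
def Simple (r : ℝ) : Prop :=
  InjOn (fun p : ℝ × ℝ => L.band p.1 p.2) (Ico (0 : ℝ) 1 ×ˢ Icc (-r) r)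

theorem continuous_inner_X (m : E) : Continuous fun t => ⟪L.X t, m⟫ :=
  L.continuous_X.inner continuous_const

theorem continuous_inner_T (m : E) : Continuous fun t => ⟪L.T t, m⟫ :=
  L.continuous_T.inner continuous_const

theorem continuous_inner_N (m : E) : Continuous fun t => ⟪L.N t, m⟫ :=
  L.continuous_N.inner continuous_const

theorem integrable_X' (m : E) (a b : ℝ) :
    IntervalIntegrable (fun t => L.v t * ⟪L.T t, m⟫) volume a b :=
  (L.integrable_v a b).mul_continuousOn (L.continuous_inner_T m).continuousOn

theorem integrable_T' (m : E) (a b : ℝ) :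
    IntervalIntegrable (fun t => L.v t * (-⟪L.X t, m⟫ + L.k t * ⟪L.N t, m⟫)) volume a b := by
  have h1 := (L.integrable_v a b).mul_continuousOn (L.continuous_inner_X m).fun_neg.continuousOn
  have h2 := (L.integrable_vk a b).mul_continuousOn (L.continuous_inner_N m).continuousOn
  refine (h1.add h2).congr (fun t _ => ?_)
  ring

theorem integrable_N' (m : E) (a b : ℝ) :
    IntervalIntegrable (fun t => L.v t * (-(L.k t * ⟪L.T t, m⟫))) volume a b := by
  have h2 := (L.integrable_vk a b).mul_continuousOn (L.continuous_inner_T m).fun_neg.continuousOn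
  refine h2.congr (fun t _ => ?_)
  ring

theorem inner_X_lt_of_T_pos {m : E} {a b : ℝ} (hab : a < b)
    (h : ∀ t ∈ Ioo a b, 0 < ⟪L.T t, m⟫) : ⟪L.X a, m⟫ < ⟪L.X b, m⟫ := by
  have := intervalIntegral.intervalIntegral_pos_of_pos_on (L.integrable_X' m a b)
    (fun t ht => mul_pos (L.v_pos t) (h t ht)) hab
  rw [← L.X_sub] at this
  linarith

theorem inner_X_lt_of_T_neg {m : E} {a b : ℝ} (hab : a < b)
    (h : ∀ t ∈ Ioo a b, ⟪L.T t, m⟫ < 0) : ⟪L.X b, m⟫ < ⟪L.X a, m⟫ := by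
  have := L.inner_X_lt_of_T_pos (m := -m) hab (fun t ht => by
    rw [inner_neg_right]; linarith [h t ht])
  simp only [inner_neg_right] at this
  linarith

/-- The curvature bound in action: while `X` stays in a spherical cap of radius `r` with
`κ ≤ cot r`, its tangent turns strictly towards the centre `m` of the cap. -/
theorem inner_T_lt_of_mem_cap {c d : ℝ} (hc : 0 < c) (hd : 0 < d) (hcd : c ^ 2 + d ^ 2 = 1)
    (hκ : κ * d ≤ c) {m : E} (hm : ‖m‖ = 1) {a b : ℝ} (hab : a < b)
    (h : ∀ t ∈ Ioo a b, c ≤ ⟪L.X t, m⟫) : ⟪L.T b, m⟫ < ⟪L.T a, m⟫ := by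
  have key : ∀ t ∈ Ioo a b, 0 < -(L.v t * (-⟪L.X t, m⟫ + L.k t * ⟪L.N t, m⟫)) := by
    intro t ht
    have hx := h t ht
    have hp := L.parseval t m
    rw [hm] at hp
    have hz : |⟪L.N t, m⟫| ≤ d := by
      apply abs_le_of_sq_le_sq _ hd.le
      nlinarith [sq_nonneg ⟪L.T t, m⟫]
    have h1 : L.k t * ⟪L.N t, m⟫ < c := by
      calc L.k t * ⟪L.N t, m⟫ ≤ |L.k t| * |⟪L.N t, m⟫| := by
            rw [← abs_mul]; exact le_abs_self _
        _ ≤ |L.k t| * d := by gcongr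
        _ < κ * d := by gcongr; exact L.abs_k_lt t
        _ ≤ c := hκ
    have := mul_pos (L.v_pos t) (show 0 < ⟪L.X t, m⟫ - L.k t * ⟪L.N t, m⟫ by linarith)
    linarith
  have := intervalIntegral.intervalIntegral_pos_of_pos_on (L.integrable_T' m a b).neg key hab
  simp only [Pi.neg_apply, intervalIntegral.integral_neg] at this
  rw [← L.T_sub] at this
  linarith

/-- Between two critical points of the height function `⟪X, m⟫`, the curve leaves the cap of
centre `m`. -/
theorem exists_inner_lt_of_inner_T_le {c d : ℝ} (hc : 0 < c) (hd : 0 < d)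
    (hcd : c ^ 2 + d ^ 2 = 1)
    (hκ : κ * d ≤ c) {m : E} (hm : ‖m‖ = 1) {a b : ℝ} (hab : a < b)
    (h : ⟪L.T a, m⟫ ≤ ⟪L.T b, m⟫) : ∃ e ∈ Ioo a b, ⟪L.X e, m⟫ < c := by
  by_contra! hcon
  exact absurd h (not_le.2 (L.inner_T_lt_of_mem_cap hc hd hcd hκ hm hab hcon))

/-- The height function `⟪X, m⟫` has the value `c` at `t`, and takes smaller values arbitrarily
close to `t` on both sides: the curve meets the cap `{x | c ≤ ⟪x, m⟫}` at `X t` and leaves it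
immediately on both sides. -/
structure IsPeak (c : ℝ) (m : E) (t : ℝ) : Prop where
  inner_eq : ⟪L.X t, m⟫ = c
  left : ∀ δ > 0, ∃ e ∈ Ioo (t - δ) t, ⟪L.X e, m⟫ < c
  right : ∀ δ > 0, ∃ e ∈ Ioo t (t + δ), ⟪L.X e, m⟫ < c

theorem isPeak {c d : ℝ} (hc : 0 < c) (hd : 0 < d) (hcd : c ^ 2 + d ^ 2 = 1)
    (hκ : κ * d ≤ c) {m : E} (hm : ‖m‖ = 1) {t : ℝ} (hX : ⟪L.X t, m⟫ = c)
    (hT : ⟪L.T t, m⟫ = 0) : L.IsPeak c m t := by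
  refine ⟨hX, fun δ hδ => ?_, fun δ hδ => ?_⟩
  · by_contra! hcon
    have h1 : ∀ s ∈ Ioo (t - δ / 2) t, 0 < ⟪L.T s, m⟫ := by
      intro s hs
      have := L.inner_T_lt_of_mem_cap hc hd hcd hκ hm hs.2
        (fun τ hτ => hcon τ ⟨by linarith [hs.1, hτ.1], hτ.2⟩)
      linarith
    have h2 := L.inner_X_lt_of_T_pos (by linarith) h1
    have h3 := hcon (t - δ / 2) ⟨by linarith, by linarith⟩
    linarith
  · by_contra! hcon
    have h1 : ∀ s ∈ Ioo t (t + δ / 2), ⟪L.T s, m⟫ < 0 := by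
      intro s hs
      have := L.inner_T_lt_of_mem_cap hc hd hcd hκ hm hs.1
        (fun τ hτ => hcon τ ⟨hτ.1, by linarith [hs.2, hτ.2]⟩)
      linarith
    have h2 := L.inner_X_lt_of_T_neg (by linarith) h1
    have h3 := hcon (t + δ / 2) ⟨by linarith, by linarith⟩
    linarith

/-- An interior maximum of the height function `⟪X, m⟫` is a critical point. -/
theorem inner_T_eq_zero_of_isMax {m : E} {a t b : ℝ} (hat : a < t) (htb : t < b)
    (h : ∀ s ∈ Icc a b, ⟪L.X s, m⟫ ≤ ⟪L.X t, m⟫) : ⟪L.T t, m⟫ = 0 := by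
  have hcont := (L.continuous_inner_T m).continuousAt (x := t)
  rcases lt_trichotomy ⟪L.T t, m⟫ 0 with h0 | h0 | h0
  · obtain ⟨δ, hδ, hlt⟩ := Metric.eventually_nhds_iff.1 (hcont.eventually_lt_const h0)
    obtain ⟨x, hx1, hx2⟩ := exists_between (show max a (t - δ) < t from max_lt hat (by linarith))
    have := L.inner_X_lt_of_T_neg (m := m) hx2 (fun s hs => hlt (by
      rw [Real.dist_eq, abs_lt]
      constructor <;> linarith [hs.1, hs.2, le_max_right a (t - δ)]))
    have := h x ⟨by linarith [le_max_left a (t - δ)], by linarith⟩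
    linarith
  · exact h0
  · obtain ⟨δ, hδ, hlt⟩ := Metric.eventually_nhds_iff.1 (hcont.eventually_const_lt h0)
    obtain ⟨x, hx1, hx2⟩ := exists_between (show t < min b (t + δ) from lt_min htb (by linarith))
    have := L.inner_X_lt_of_T_pos (m := m) hx1 (fun s hs => hlt (by
      rw [Real.dist_eq, abs_lt]
      constructor <;> linarith [hs.1, hs.2, min_le_right b (t + δ)]))
    have := h x ⟨by linarith, by linarith [min_le_left b (t + δ)]⟩
    linarith

theorem norm_band (t θ : ℝ) : ‖L.band t θ‖ = 1 := by
  have h : ‖L.band t θ‖ ^ 2 = 1 := by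
    rw [band, norm_add_sq_real, norm_smul, norm_smul, inner_smul_left, inner_smul_right,
      L.inner_X_N, L.norm_X, L.norm_N]
    simp
  nlinarith [norm_nonneg (L.band t θ)]

theorem inner_X_band (t θ : ℝ) : ⟪L.X t, L.band t θ⟫ = cos θ := by
  simp [band, inner_add_right, inner_smul_right, L.inner_X_N, L.norm_X]

theorem inner_N_band (t θ : ℝ) : ⟪L.N t, L.band t θ⟫ = sin θ := by
  rw [band, inner_add_right, inner_smul_right, inner_smul_right, real_inner_comm, L.inner_X_N,
    real_inner_self_eq_norm_sq, L.norm_N]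
  ring

theorem inner_T_band (t θ : ℝ) : ⟪L.T t, L.band t θ⟫ = 0 := by
  rw [band, inner_add_right, inner_smul_right, inner_smul_right, L.inner_T_N,
    real_inner_comm, L.inner_X_T]
  simp

theorem periodic_band (θ : ℝ) : Function.Periodic (fun t => L.band t θ) 1 := by
  intro t
  simp only [band]
  rw [L.periodic_X, L.periodic_N]

theorem fract_band (t θ : ℝ) : L.band (Int.fract t) θ = L.band t θ := by
  have := (L.periodic_band θ).sub_zsmul_eq ⌊t⌋ (x := t)
  rwa [zsmul_one] at this

/-- A critical point of the height function `⟪X, m⟫` with height at least `cos r` exhibits `m` as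
a point of the band of half-width `r`. -/
theorem exists_eq_band {r : ℝ} (hr0 : 0 < r) (hr : r < π / 2) {m : E} (hm : ‖m‖ = 1) {t : ℝ}
    (hX : cos r ≤ ⟪L.X t, m⟫) (hT : ⟪L.T t, m⟫ = 0) : ∃ θ ∈ Icc (-r) r, L.band t θ = m := by
  have hp := L.parseval t m
  rw [hT, hm] at hp
  have hc : 0 < cos r := cos_pos_of_mem_Ioo ⟨by linarith, hr⟩
  have hz : ⟪L.N t, m⟫ ^ 2 ≤ sin r ^ 2 := by nlinarith [sin_sq_add_cos_sq r]
  have hs : 0 < sin r := sin_pos_of_pos_of_lt_pi hr0 (by linarith)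
  have habs := abs_le_of_sq_le_sq' hz hs.le
  refine ⟨arcsin ⟪L.N t, m⟫, ⟨?_, ?_⟩, ?_⟩
  · rw [← arcsin_sin (x := -r) (by linarith) (by linarith), sin_neg]
    exact monotone_arcsin habs.1
  · rw [← arcsin_sin (x := r) (by linarith) (by linarith)]
    exact monotone_arcsin habs.2
  · have hcos : cos (arcsin ⟪L.N t, m⟫) = ⟪L.X t, m⟫ := by
      rw [cos_arcsin, show 1 - ⟪L.N t, m⟫ ^ 2 = ⟪L.X t, m⟫ ^ 2 by linarith, sqrt_sq (by linarith)]
    have hsin : sin (arcsin ⟪L.N t, m⟫) = ⟪L.N t, m⟫ :=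
      sin_arcsin (by linarith [neg_one_le_sin r, sin_le_one r]) (by linarith [sin_le_one r])
    have : ‖L.band t (arcsin ⟪L.N t, m⟫) - m‖ ^ 2 = 0 := by
      rw [norm_sub_sq_real, norm_band, hm, band, inner_add_left, inner_smul_left, inner_smul_left,
        hcos, hsin]
      simp only [conj_trivial]
      linarith
    exact sub_eq_zero.1 (norm_eq_zero.1 (pow_eq_zero_iff two_ne_zero |>.1 this))

/-! ### Two separate peaks -/

/-- Some height function `⟪X, M⟫` exceeds the level `c` on two arcs of the loop that are separated
by points below that level: the open cap of centre `M / ‖M‖` meets the curve in a disconnected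
set of times. -/
def TwoPeaks (c : ℝ) : Prop :=
  ∃ (M : E) (e₁ t₁ e₂ t₂ : ℝ), e₁ < t₁ ∧ t₁ < e₂ ∧ e₂ < t₂ ∧ t₂ < e₁ + 1 ∧
    ⟪L.X e₁, M⟫ < c * ‖M‖ ∧ c * ‖M‖ < ⟪L.X t₁, M⟫ ∧
    ⟪L.X e₂, M⟫ < c * ‖M‖ ∧ c * ‖M‖ < ⟪L.X t₂, M⟫

theorem exists_isMax {M : E} {a t b x : ℝ} (hat : a < t) (htb : t < b)
    (ha : ⟪L.X a, M⟫ < x) (ht : x < ⟪L.X t, M⟫) (hb : ⟪L.X b, M⟫ < x) :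
    ∃ s ∈ Ioo a b, x < ⟪L.X s, M⟫ ∧ ⟪L.T s, M⟫ = 0 := by
  obtain ⟨s, hs, hmax⟩ := isCompact_Icc.exists_isMaxOn (nonempty_Icc.2 (hat.trans htb).le)
    (L.continuous_inner_X M).continuousOn
  have hts : ⟪L.X t, M⟫ ≤ ⟪L.X s, M⟫ := hmax ⟨hat.le, htb.le⟩
  have h1 : a < s := lt_of_le_of_ne hs.1 (by rintro rfl; linarith)
  have h2 : s < b := lt_of_le_of_ne hs.2 (by rintro rfl; linarith)
  exact ⟨s, ⟨h1, h2⟩, by linarith, L.inner_T_eq_zero_of_isMax h1 h2 (fun y hy => hmax hy)⟩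

theorem not_simple_of_twoPeaks {r : ℝ} (hr0 : 0 < r) (hr : r < π / 2)
    (h : L.TwoPeaks (cos r)) : ¬ L.Simple r := by
  obtain ⟨M, e₁, t₁, e₂, t₂, h1, h2, h3, h4, he1, ht1, he2, ht2⟩ := h
  have he1' : ⟪L.X (e₁ + 1), M⟫ < cos r * ‖M‖ := by rwa [L.periodic_X]
  obtain ⟨s₁, hs1, hx1, hT1⟩ := L.exists_isMax h1 h2 he1 ht1 he2
  obtain ⟨s₂, hs2, hx2, hT2⟩ := L.exists_isMax h3 h4 he2 ht2 he1'
  have hM : 0 < ‖M‖ := norm_pos_iff.2 (by rintro rfl; simp at he1)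
  have hm : ‖(‖M‖⁻¹ • M)‖ = 1 := by
    rw [norm_smul, norm_inv, norm_norm, inv_mul_cancel₀ hM.ne']
  have key : ∀ s, cos r * ‖M‖ < ⟪L.X s, M⟫ → ⟪L.T s, M⟫ = 0 →
      ∃ θ ∈ Icc (-r) r, L.band s θ = ‖M‖⁻¹ • M := by
    intro s hs hT
    refine L.exists_eq_band hr0 hr hm ?_ ?_
    · rw [inner_smul_right, inv_mul_eq_div, le_div_iff₀ hM]
      exact hs.le
    · rw [inner_smul_right, hT, mul_zero]
  obtain ⟨θ₁, hθ1, hb1⟩ := key s₁ hx1 hT1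
  obtain ⟨θ₂, hθ2, hb2⟩ := key s₂ hx2 hT2
  intro hinj
  have := @hinj (Int.fract s₁, θ₁)
    ⟨⟨Int.fract_nonneg _, Int.fract_lt_one _⟩, hθ1⟩ (Int.fract s₂, θ₂)
    ⟨⟨Int.fract_nonneg _, Int.fract_lt_one _⟩, hθ2⟩
    (by simp only [fract_band, hb1, hb2])
  obtain ⟨z, hz⟩ := Int.fract_eq_fract.1 (congrArg Prod.fst this)
  have hz1 : (z : ℝ) < 0 := by linarith [hs1.1, hs1.2, hs2.1, hs2.2]
  have hz2 : (-1 : ℝ) < z := by linarith [hs1.1, hs1.2, hs2.1, hs2.2]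
  have : z < 0 := by exact_mod_cast hz1
  have : -1 < z := by exact_mod_cast hz2
  omega

/-- Having two separate peaks is an open condition, as it only involves finitely many strict
inequalities. -/
theorem TwoPeaks.exists_stable {L : FramedLoop κ E} {c : ℝ} (h : L.TwoPeaks c) :
    ∃ ε > 0, ∀ L' : FramedLoop κ E, (∀ t, ‖L'.X t - L.X t‖ < ε) → L'.TwoPeaks c := by
  obtain ⟨M, e₁, t₁, e₂, t₂, h1, h2, h3, h4, he1, ht1, he2, ht2⟩ := h
  have hM : 0 < ‖M‖ := norm_pos_iff.2 (by rintro rfl; simp at he1)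
  obtain ⟨η, hη, hη'⟩ := exists_between (show 0 < min (min (c * ‖M‖ - ⟪L.X e₁, M⟫)
    (⟪L.X t₁, M⟫ - c * ‖M‖)) (min (c * ‖M‖ - ⟪L.X e₂, M⟫) (⟪L.X t₂, M⟫ - c * ‖M‖)) by
      refine lt_min (lt_min ?_ ?_) (lt_min ?_ ?_) <;> linarith)
  simp only [lt_min_iff] at hη'
  refine ⟨η / ‖M‖, by positivity, fun L' hL' => ⟨M, e₁, t₁, e₂, t₂, h1, h2, h3, h4, ?_⟩⟩
  have key : ∀ t, |⟪L'.X t, M⟫ - ⟪L.X t, M⟫| ≤ η := by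
    intro t
    rw [← inner_sub_left]
    calc _ ≤ ‖L'.X t - L.X t‖ * ‖M‖ := abs_real_inner_le_norm _ _
      _ ≤ η / ‖M‖ * ‖M‖ := by gcongr; exact (hL' t).le
      _ = η := div_mul_cancel₀ _ hM.ne'
  have k1 := abs_le.1 (key e₁)
  have k2 := abs_le.1 (key t₁)
  have k3 := abs_le.1 (key e₂)
  have k4 := abs_le.1 (key t₂)
  refine ⟨?_, ?_, ?_, ?_⟩ <;> linarith [hη'.1.1, hη'.1.2, hη'.2.1, hη'.2.2]

end FramedLoop

namespace FramedLoop

variable {κ : ℝ} {E : Type*} [NormedAddCommGroup E] [InnerProductSpace ℝ E] (L : FramedLoop κ E)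

/-! ### Moving the centre of a cap -/

theorem eventually_lt_inner_add_smul {c : ℝ} {x m : E} (h : c < ⟪x, m⟫) (hm : ‖m‖ = 1) (y : E) :
    ∀ᶠ ε : ℝ in 𝓝[>] 0, c * ‖m + ε • y‖ < ⟪x, m + ε • y⟫ := by
  have h1 : Continuous fun ε : ℝ => c * ‖m + ε • y‖ := by fun_prop
  have h2 : Continuous fun ε : ℝ => ⟪x, m + ε • y⟫ := by fun_prop
  refine (nhdsWithin_le_nhds : 𝓝[>] (0 : ℝ) ≤ 𝓝 0)
    ((h1.tendsto 0).eventually_lt (h2.tendsto 0) ?_)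
  simpa [hm] using h

theorem lt_inner_add_smul_self {c : ℝ} (hc : 0 < c) (hc1 : c < 1) {x m : E} (hx : ‖x‖ = 1)
    (hm : ‖m‖ = 1) (h : ⟪x, m⟫ = c) {ε : ℝ} (hε : 0 < ε) : c * ‖m + ε • x‖ < ⟪x, m + ε • x⟫ := by
  have h1 : ⟪x, m + ε • x⟫ = c + ε := by
    rw [inner_add_right, inner_smul_right, h, real_inner_self_eq_norm_sq, hx]; ring
  have h2 : ‖m + ε • x‖ ^ 2 = 1 + 2 * ε * c + ε ^ 2 := by
    rw [norm_add_sq_real, inner_smul_right, real_inner_comm, h, norm_smul, hx, hm, mul_one,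
      Real.norm_eq_abs, sq_abs]
    ring
  rw [h1]
  refine lt_of_pow_lt_pow_left₀ 2 (by positivity) ?_
  rw [mul_pow, h2]
  have : 0 < ε * (2 * c * (1 - c ^ 2)) + ε ^ 2 * (1 - c ^ 2) := by
    have : 0 < 1 - c ^ 2 := by nlinarith
    positivity
  linarith

/-- If the points `x₁`, `x₂` lie in the closed cap `{x | c ≤ ⟪x, m⟫}`, then the cap can be moved
slightly so that both come to lie in its interior, unless they are antipodal points of its
boundary circle. -/
theorem exists_eventually_lt_inner {c : ℝ} (hc : 0 < c) (hc1 : c < 1) {x₁ x₂ m : E}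
    (hx₁ : ‖x₁‖ = 1) (hx₂ : ‖x₂‖ = 1) (hm : ‖m‖ = 1) (h₁ : c ≤ ⟪x₁, m⟫) (h₂ : c ≤ ⟪x₂, m⟫)
    (h : ¬(⟪x₂, m⟫ = c ∧ x₁ + x₂ = (2 * c) • m)) :
    ∃ y : E, ∀ᶠ ε : ℝ in 𝓝[>] 0,
      c * ‖m + ε • y‖ < ⟪x₁, m + ε • y⟫ ∧ c * ‖m + ε • y‖ < ⟪x₂, m + ε • y⟫ := by
  rcases h₁.lt_or_eq with h₁ | h₁
  · refine ⟨x₂, (eventually_lt_inner_add_smul h₁ hm x₂).and ?_⟩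
    rcases h₂.lt_or_eq with h₂ | h₂
    · exact eventually_lt_inner_add_smul h₂ hm x₂
    · filter_upwards [self_mem_nhdsWithin] with ε hε
        using lt_inner_add_smul_self hc hc1 hx₂ hm h₂.symm hε
  rcases h₂.lt_or_eq with h₂ | h₂
  · refine ⟨x₁, Eventually.and ?_ (eventually_lt_inner_add_smul h₂ hm x₁)⟩
    filter_upwards [self_mem_nhdsWithin] with ε hε
      using lt_inner_add_smul_self hc hc1 hx₁ hm h₁.symm hε
  have hy : (2 * c) ^ 2 < ‖x₁ + x₂‖ ^ 2 := by
    have h0 : 0 < ‖x₁ + x₂ - (2 * c) • m‖ ^ 2 := by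
      have : x₁ + x₂ - (2 * c) • m ≠ 0 := fun h0 => h ⟨h₂.symm, sub_eq_zero.1 h0⟩
      positivity
    rw [norm_sub_sq_real, inner_smul_right, inner_add_left, ← h₁, ← h₂, norm_smul, hm, mul_one,
      Real.norm_eq_abs, sq_abs] at h0
    linarith
  have hi : ‖x₁ + x₂‖ ^ 2 = 2 * (1 + ⟪x₁, x₂⟫) := by
    rw [norm_add_sq_real, hx₁, hx₂]; ring
  refine ⟨x₁ + x₂, ?_⟩
  filter_upwards [self_mem_nhdsWithin] with ε (hε : 0 < ε)
  have e1 : ⟪x₁, m + ε • (x₁ + x₂)⟫ = c + ε * (‖x₁ + x₂‖ ^ 2 / 2) := by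
    rw [hi, inner_add_right, inner_smul_right, inner_add_right, ← h₁, real_inner_self_eq_norm_sq,
      hx₁]
    ring
  have e2 : ⟪x₂, m + ε • (x₁ + x₂)⟫ = c + ε * (‖x₁ + x₂‖ ^ 2 / 2) := by
    rw [hi, inner_add_right, inner_smul_right, inner_add_right, ← h₂, real_inner_self_eq_norm_sq,
      hx₂, real_inner_comm]
    ring
  rw [e1, e2, and_self]
  refine lt_of_pow_lt_pow_left₀ 2 (by positivity) ?_
  have e3 : ‖m + ε • (x₁ + x₂)‖ ^ 2 = 1 + 4 * ε * c + ε ^ 2 * ‖x₁ + x₂‖ ^ 2 := by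
    rw [norm_add_sq_real, inner_smul_right, real_inner_comm, inner_add_left, ← h₁, ← h₂,
      norm_smul, hm, mul_pow, Real.norm_eq_abs, sq_abs]
    ring
  rw [mul_pow, e3]
  have : 0 < ε * (‖x₁ + x₂‖ ^ 2 - (2 * c) ^ 2) * (c + ε * ‖x₁ + x₂‖ ^ 2 / 4) := by
    have := sub_pos.2 hy
    positivity
  nlinarith

/-- Without two separate peaks, two points of the loop in a closed cap that are separated by times
outside the cap must be antipodal points of the boundary of the cap. -/
theorem add_eq_of_not_twoPeaks {c : ℝ} (hc : 0 < c) (hc1 : c < 1) (hW : ¬ L.TwoPeaks c) {m : E}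
    (hm : ‖m‖ = 1) {e₁ t₁ e₂ t₂ : ℝ} (h1 : e₁ < t₁) (h2 : t₁ < e₂) (h3 : e₂ < t₂)
    (h4 : t₂ < e₁ + 1) (he1 : ⟪L.X e₁, m⟫ < c) (ht1 : c ≤ ⟪L.X t₁, m⟫)
    (he2 : ⟪L.X e₂, m⟫ < c) (ht2 : c ≤ ⟪L.X t₂, m⟫) :
    ⟪L.X t₂, m⟫ = c ∧ L.X t₁ + L.X t₂ = (2 * c) • m := by
  by_contra hcon
  obtain ⟨y, hy⟩ := exists_eventually_lt_inner hc hc1 (L.norm_X t₁) (L.norm_X t₂) hm ht1 ht2 hcon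
  have key : ∀ e, ⟪L.X e, m⟫ < c →
      ∀ᶠ ε : ℝ in 𝓝[>] 0, ⟪L.X e, m + ε • y⟫ < c * ‖m + ε • y‖ := by
    intro e he
    have := eventually_lt_inner_add_smul (x := -L.X e) (c := -c) (by
      rw [inner_neg_left]; linarith) hm y
    filter_upwards [this] with ε hε
    rw [inner_neg_left] at hε
    linarith
  obtain ⟨ε, hε, hε1, hε2⟩ := (hy.and ((key _ he1).and (key _ he2))).exists
  exact hW ⟨m + ε • y, e₁, t₁, e₂, t₂, h1, h2, h3, h4, hε1, hε.1, hε2, hε.2⟩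

theorem X_add_int (t : ℝ) (n : ℤ) : L.X (t + n) = L.X t := by
  have := L.periodic_X.int_mul n t
  rwa [mul_one] at this

/-- A time that differs from `t` modulo the period can be moved into `(t, t + 1)`. -/
theorem exists_int_add_mem_Ioo {t s : ℝ} (h : ∀ n : ℤ, s ≠ t + n) :
    ∃ n : ℤ, s + n ∈ Ioo t (t + 1) := by
  refine ⟨-⌊s - t⌋, ?_, ?_⟩
  · refine lt_of_le_of_ne ?_ (fun h' => h ⌊s - t⌋ ?_)
    · push_cast; linarith [Int.floor_le (s - t)]
    · push_cast at h'; linarith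
  · push_cast; linarith [Int.lt_floor_add_one (s - t)]

variable {L} in
/-- A closed cap that the curve only touches at time `t` contains no other point of a curve without
two separate peaks, except possibly the point of its boundary opposite to `X t`. -/
theorem IsPeak.add_eq {c : ℝ} (hc : 0 < c) (hc1 : c < 1) (hW : ¬ L.TwoPeaks c) {m : E}
    (hm : ‖m‖ = 1) {t s : ℝ} (ht : L.IsPeak c m t) (hs : c ≤ ⟪L.X s, m⟫)
    (hst : ∀ n : ℤ, s ≠ t + n) : ⟪L.X s, m⟫ = c ∧ L.X t + L.X s = (2 * c) • m := by
  obtain ⟨n, hn1, hn2⟩ := exists_int_add_mem_Ioo hst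
  rw [← L.X_add_int s n] at hs ⊢
  obtain ⟨e₁, he1, he1'⟩ := ht.left (t + 1 - (s + n)) (by linarith)
  obtain ⟨e₂, he2, he2'⟩ := ht.right (s + n - t) (by linarith)
  exact L.add_eq_of_not_twoPeaks hc hc1 hW hm he1.2 he2.1 (by linarith [he2.2])
    (by linarith [he1.1]) he1' ht.inner_eq.ge he2' hs

variable {L} in
/-- Near two opposite contact points of a cap, the two strands of a curve without two separate
peaks stay at spherical distance at least twice the radius of the cap. -/
theorem IsPeak.eventually_inner_le {c : ℝ} (hc : 0 < c) (hW : ¬ L.TwoPeaks c)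
    {m : E} (hm : ‖m‖ = 1) {t s : ℝ} (ht : L.IsPeak c m t) (hts : L.X t + L.X s = (2 * c) • m)
    (hst : ∀ n : ℤ, s ≠ t + n) :
    ∃ δ > 0, ∀ τ σ, |τ - t| < δ → |σ - s| < δ → ⟪L.X τ, L.X σ⟫ ≤ 2 * c ^ 2 - 1 := by
  obtain ⟨n, hn1, hn2⟩ := exists_int_add_mem_Ioo hst
  obtain ⟨e₁, he1, he1'⟩ := ht.left (t + 1 - (s + n)) (by linarith)
  obtain ⟨e₂, he2, he2'⟩ := ht.right (s + n - t) (by linarith)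
  have hM : Continuous fun p : ℝ × ℝ => L.X p.1 + L.X p.2 :=
    (L.continuous_X.comp continuous_fst).add (L.continuous_X.comp continuous_snd)
  have key : ∀ e, ⟪L.X e, m⟫ < c → ∀ᶠ p in 𝓝 (t, s),
      ⟪L.X e, L.X p.1 + L.X p.2⟫ < c * ‖L.X p.1 + L.X p.2‖ := by
    intro e he
    refine ((continuous_const.inner hM).tendsto (t, s)).eventually_lt
      ((continuous_const.mul hM.norm).tendsto (t, s)) ?_
    change ⟪L.X e, L.X t + L.X s⟫ < c * ‖L.X t + L.X s‖
    rw [hts, inner_smul_right, norm_smul, hm, mul_one, Real.norm_of_nonneg (by positivity)]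
    nlinarith
  have hev1 : ∀ᶠ p : ℝ × ℝ in 𝓝 (t, s), p.1 ∈ Ioo e₁ e₂ :=
    continuousAt_fst.eventually (Ioo_mem_nhds he1.2 he2.1)
  have hev2 : ∀ᶠ p : ℝ × ℝ in 𝓝 (t, s), p.2 ∈ Ioo (e₂ - n) (e₁ + 1 - n) :=
    continuousAt_snd.eventually
      (Ioo_mem_nhds (by linarith [he2.2]) (by linarith [he1.1]))
  obtain ⟨δ, hδ, hall⟩ := Metric.eventually_nhds_iff.1
    (hev1.and (hev2.and ((key _ he1').and (key _ he2'))))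
  refine ⟨δ, hδ, fun τ σ hτ hσ => ?_⟩
  obtain ⟨p1, p2, p3, p4⟩ := hall (y := (τ, σ)) (by
    rw [Prod.dist_eq]; exact max_lt hτ hσ)
  simp only at p1 p2 p3 p4
  by_contra! hcon
  have hsq : ‖L.X τ + L.X σ‖ ^ 2 = 2 * (1 + ⟪L.X τ, L.X σ⟫) := by
    rw [norm_add_sq_real, L.norm_X, L.norm_X]; ring
  have hlt : 2 * c < ‖L.X τ + L.X σ‖ :=
    lt_of_pow_lt_pow_left₀ 2 (norm_nonneg _) (by rw [hsq]; linarith)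
  refine hW ⟨L.X τ + L.X σ, e₁, τ, e₂, σ + n, p1.1, p1.2, by linarith [p2.1], by linarith [p2.2],
    p3, ?_, p4, ?_⟩
  · rw [inner_add_right, real_inner_self_eq_norm_sq, L.norm_X]
    nlinarith
  · rw [X_add_int, inner_add_right, real_inner_self_eq_norm_sq, L.norm_X, real_inner_comm]
    nlinarith

/-! ### Changes of sign -/

/-- `H` has opposite signs immediately before and immediately after `t`. -/
def SignChange (H : ℝ → ℝ) (t : ℝ) : Prop :=
  ∃ δ > 0, ∀ x ∈ Ioo (t - δ) t, ∀ y ∈ Ioo t (t + δ), H x * H y < 0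

theorem signChange_inner {n : E} {t : ℝ} (h0 : ⟪L.X t, n⟫ = 0) (h : ⟪L.T t, n⟫ ≠ 0) :
    SignChange (fun τ => ⟪L.X τ, n⟫) t := by
  have hpos : ∀ n : E, ⟪L.X t, n⟫ = 0 → 0 < ⟪L.T t, n⟫ →
      SignChange (fun τ => ⟪L.X τ, n⟫) t := by
    intro n h0 hn
    obtain ⟨δ, hδ, hlt⟩ := Metric.eventually_nhds_iff.1
      ((L.continuous_inner_T n).continuousAt.eventually_const_lt hn)
    refine ⟨δ, hδ, fun x hx y hy => mul_neg_of_neg_of_pos ?_ ?_⟩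
    · have := L.inner_X_lt_of_T_pos (m := n) hx.2 (fun s hs => hlt (by
        rw [Real.dist_eq, abs_lt]
        constructor <;> linarith [hs.1, hs.2, hx.1]))
      linarith
    · have := L.inner_X_lt_of_T_pos (m := n) hy.1 (fun s hs => hlt (by
        rw [Real.dist_eq, abs_lt]
        constructor <;> linarith [hs.1, hs.2, hy.2]))
      linarith
  rcases lt_or_gt_of_ne h with h | h
  · have := hpos (-n) (by rw [inner_neg_right, h0, neg_zero]) (by rw [inner_neg_right]; linarith)
    simpa only [SignChange, inner_neg_right, neg_mul_neg] using this
  · exact hpos n h0 h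

theorem SignChange.exists_eq {H : ℝ → ℝ} (hH : Continuous H) {t : ℝ} (h : SignChange H t) {δ : ℝ}
    (hδ : 0 < δ) : ∃ h₀ > 0, ∀ y, |y| < h₀ → ∃ τ, |τ - t| < δ ∧ H τ = y := by
  obtain ⟨δ', hδ', hs⟩ := h
  obtain ⟨η, hη, hη'⟩ := exists_between (lt_min hδ hδ')
  rw [lt_min_iff] at hη'
  have h0 := hs (t - η) ⟨by linarith, by linarith⟩ (t + η) ⟨by linarith, by linarith⟩
  have hne1 : H (t - η) ≠ 0 := fun h => by rw [h, zero_mul] at h0; exact h0.false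
  have hne2 : H (t + η) ≠ 0 := fun h => by rw [h, mul_zero] at h0; exact h0.false
  refine ⟨min |H (t - η)| |H (t + η)|, lt_min (abs_pos.2 hne1) (abs_pos.2 hne2), fun y hy => ?_⟩
  rw [lt_min_iff] at hy
  have hmem : y ∈ uIcc (H (t - η)) (H (t + η)) := by
    rcases mul_neg_iff.1 h0 with ⟨h1, h2⟩ | ⟨h1, h2⟩
    · rw [abs_of_pos h1, abs_of_neg h2, abs_lt, abs_lt] at hy
      rw [uIcc_of_ge (by linarith)]
      exact ⟨by linarith, by linarith⟩
    · rw [abs_of_neg h1, abs_of_pos h2, abs_lt, abs_lt] at hy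
      rw [uIcc_of_le (by linarith)]
      exact ⟨by linarith, by linarith⟩
  obtain ⟨τ, hτ, rfl⟩ := intermediate_value_uIcc hH.continuousOn hmem
  rw [uIcc_of_le (by linarith)] at hτ
  exact ⟨τ, by rw [abs_lt]; constructor <;> linarith [hτ.1, hτ.2], rfl⟩

/-- A continuous function with `H (t + 1/2) = -H t` has an odd number of sign changes in each half
period; in particular, given two of them, it has a third zero. -/
theorem exists_third_zero {H : ℝ → ℝ} (hH : Continuous H) (hanti : ∀ t, H (t + 1 / 2) = -H t)
    {a b : ℝ} (hab : a < b) (hba : b < a + 1 / 2) (ha : SignChange H a) (hb : SignChange H b) :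
    ∃ s ∈ Ioo a (a + 1 / 2), s ≠ b ∧ H s = 0 := by
  by_contra! hcon
  have hconst : ∀ x y, x ≤ y → (∀ s ∈ Icc x y, H s ≠ 0) → 0 < H x * H y := by
    intro x y hxy h
    by_contra! hle
    have : (0 : ℝ) ∈ uIcc (H x) (H y) := by
      rcases mul_nonpos_iff.1 hle with h | h
      · exact mem_uIcc.2 (Or.inr ⟨h.2, h.1⟩)
      · exact mem_uIcc.2 (Or.inl ⟨h.1, h.2⟩)
    obtain ⟨s, hs, hs0⟩ := intermediate_value_uIcc hH.continuousOn this
    rw [uIcc_of_le hxy] at hs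
    exact h s hs hs0
  obtain ⟨δa, hδa, hsa⟩ := ha
  obtain ⟨δb, hδb, hsb⟩ := hb
  obtain ⟨η, hη0, hη⟩ := exists_between (show 0 < min (min δa δb)
    (min ((b - a) / 2) ((a + 1 / 2 - b) / 2)) from
      lt_min (lt_min hδa hδb) (lt_min (by linarith) (by linarith)))
  simp only [lt_min_iff] at hη
  obtain ⟨⟨hη1, hη2⟩, hη3, hη4⟩ := hη
  have s1 := hsa (a - η) ⟨by linarith, by linarith⟩ (a + η) ⟨by linarith, by linarith⟩
  have s2 := hsb (b - η) ⟨by linarith, by linarith⟩ (b + η) ⟨by linarith, by linarith⟩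
  have s3 := hconst (a + η) (b - η) (by linarith) (fun s hs =>
    hcon s ⟨by linarith [hs.1], by linarith [hs.2]⟩ (by linarith [hs.2] : s < b).ne)
  have s4 := hconst (b + η) (a - η + 1 / 2) (by linarith) (fun s hs =>
    hcon s ⟨by linarith [hs.1], by linarith [hs.2]⟩ (by linarith [hs.1] : b < s).ne')
  rw [hanti] at s4
  -- the four signs at `a - η`, `a + η`, `b - η`, `b + η` are incompatible
  have p1 : 0 < (H (a - η) * H (a + η)) * (H (b - η) * H (b + η)) := mul_pos_of_neg_of_neg s1 s2
  have p2 := mul_pos s3 s4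
  nlinarith

end FramedLoop

/-! ### Coordinates -/

/-- `m`, `u`, `n` form an orthonormal basis of `E`. -/
structure IsONB {E : Type*} [NormedAddCommGroup E] [InnerProductSpace ℝ E] (m u n : E) : Prop where
  norm_m : ‖m‖ = 1
  norm_u : ‖u‖ = 1
  norm_n : ‖n‖ = 1
  inner_m_u : ⟪m, u⟫ = 0
  inner_m_n : ⟪m, n⟫ = 0
  inner_u_n : ⟪u, n⟫ = 0
  expand : ∀ x, x = ⟪x, m⟫ • m + ⟪x, u⟫ • u + ⟪x, n⟫ • n

theorem inner_comb {E : Type*} [NormedAddCommGroup E] [InnerProductSpace ℝ E] (x m u : E)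
    (a b : ℝ) : ⟪x, a • m + b • u⟫ = ⟪x, m⟫ * a + ⟪x, u⟫ * b := by
  rw [inner_add_right, inner_smul_right, inner_smul_right]
  ring

namespace IsONB

variable {E : Type*} [NormedAddCommGroup E] [InnerProductSpace ℝ E] {m u n : E}

theorem inner_eq (B : IsONB m u n) (x y : E) :
    ⟪x, y⟫ = ⟪x, m⟫ * ⟪y, m⟫ + ⟪x, u⟫ * ⟪y, u⟫ + ⟪x, n⟫ * ⟪y, n⟫ := by
  conv_lhs => rw [B.expand y]
  simp only [inner_add_right, inner_smul_right]
  ring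

theorem norm_sq_eq (B : IsONB m u n) (x : E) :
    ‖x‖ ^ 2 = ⟪x, m⟫ ^ 2 + ⟪x, u⟫ ^ 2 + ⟪x, n⟫ ^ 2 := by
  rw [← real_inner_self_eq_norm_sq, B.inner_eq]
  ring

theorem neg_u (B : IsONB m u n) : IsONB m (-u) n where
  norm_m := B.norm_m
  norm_u := by rw [norm_neg, B.norm_u]
  norm_n := B.norm_n
  inner_m_u := by rw [inner_neg_right, B.inner_m_u, neg_zero]
  inner_m_n := B.inner_m_n
  inner_u_n := by rw [inner_neg_left, B.inner_u_n, neg_zero]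
  expand x := by
    rw [inner_neg_right, neg_smul_neg]
    exact B.expand x

theorem inner_comb_m (B : IsONB m u n) (a b : ℝ) : ⟪a • m + b • u, m⟫ = a := by
  rw [inner_add_left, inner_smul_left, inner_smul_left, real_inner_self_eq_norm_sq, B.norm_m,
    real_inner_comm, B.inner_m_u]
  simp

theorem inner_comb_u (B : IsONB m u n) (a b : ℝ) : ⟪a • m + b • u, u⟫ = b := by
  rw [inner_add_left, inner_smul_left, inner_smul_left, real_inner_self_eq_norm_sq, B.norm_u,
    B.inner_m_u]
  simp

theorem inner_comb_n (B : IsONB m u n) (a b : ℝ) : ⟪a • m + b • u, n⟫ = 0 := by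
  rw [inner_add_left, inner_smul_left, inner_smul_left, B.inner_m_n, B.inner_u_n]
  simp

theorem norm_comb (B : IsONB m u n) {a b : ℝ} (h : a ^ 2 + b ^ 2 = 1) : ‖a • m + b • u‖ = 1 := by
  have : ‖a • m + b • u‖ ^ 2 = 1 := by
    rw [B.norm_sq_eq, B.inner_comb_m, B.inner_comb_u, B.inner_comb_n]
    linarith
  nlinarith [norm_nonneg (a • m + b • u)]

end IsONB

/-- Two points at the same height `h ≠ 0` whose spherical distance is at least `π / 3` differ in
longitude by more than `π / 3`. Here `(a, b)` and `(a', b')` are horizontal coordinates of the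
points in two frames turned by `π / 3` (so `c = √3 / 2`) with respect to each other, and longitude
relative to these frames is measured by the slopes `b / a` and `b' / a'`. -/
theorem slope_lt_slope {c a b a' b' h : ℝ} (hc : 0 < c) (hc2 : c ^ 2 = 3 / 4)
    (h1 : a ^ 2 + b ^ 2 + h ^ 2 = 1) (h2 : a' ^ 2 + b' ^ 2 + h ^ 2 = 1) (ha : 4 / 5 < a)
    (ha' : 4 / 5 < a') (hh : h ≠ 0)
    (hle : (a * a' + b * b') / 2 + c * (b * a' - a * b') + h ^ 2 ≤ 1 / 2) :
    b / a < b' / a' := by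
  have hh2 : 0 < h ^ 2 := by positivity
  rw [div_lt_div_iff₀ (by linarith) (by linarith)]
  by_contra! hcon
  have hP : 0 < a * a' + b * b' := by
    have e1 : 16 / 25 < a * a' := by nlinarith
    have e2 : b ^ 2 < 9 / 25 := by nlinarith
    have e3 : b' ^ 2 < 9 / 25 := by nlinarith
    nlinarith [sq_nonneg (b + b')]
  obtain ⟨P, hPdef⟩ : ∃ P, P = a * a' + b * b' := ⟨_, rfl⟩
  obtain ⟨S, hSdef⟩ : ∃ S, S = b * a' - a * b' := ⟨_, rfl⟩
  have hS : 0 ≤ S := by rw [hSdef]; linarith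
  rw [← hPdef] at hle hP
  rw [← hSdef] at hle
  have hPS : P ^ 2 + S ^ 2 = (1 - h ^ 2) ^ 2 := by
    have e1 : a ^ 2 + b ^ 2 = 1 - h ^ 2 := by linarith
    have e2 : a' ^ 2 + b' ^ 2 = 1 - h ^ 2 := by linarith
    have e3 : P ^ 2 + S ^ 2 = (a ^ 2 + b ^ 2) * (a' ^ 2 + b' ^ 2) := by rw [hPdef, hSdef]; ring
    rw [e3, e1, e2]
    ring
  have hlt : P + 2 * c * S < 1 - h ^ 2 := by linarith
  have : (P + 2 * c * S) ^ 2 < (1 - h ^ 2) ^ 2 := by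
    have : 0 ≤ P + 2 * c * S := by positivity
    gcongr
  have e : (P + 2 * c * S) ^ 2 = P ^ 2 + 4 * (c * (P * S)) + 4 * c ^ 2 * S ^ 2 := by ring
  rw [e, hc2] at this
  have : 0 ≤ c * (P * S) := by positivity
  nlinarith [sq_nonneg S]

namespace FramedLoop

variable {κ : ℝ} {E : Type*} [NormedAddCommGroup E] [InnerProductSpace ℝ E] {L : FramedLoop κ E}

theorem IsPeak.add_half {c : ℝ} {m : E} {t : ℝ} (h : L.IsPeak c m t)
    (hA : ∀ t, L.X (t + 1 / 2) = -L.X t) : L.IsPeak c (-m) (t + 1 / 2) := by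
  refine ⟨by rw [hA, inner_neg_neg, h.inner_eq], fun δ hδ => ?_, fun δ hδ => ?_⟩
  · obtain ⟨e, he, he'⟩ := h.left δ hδ
    exact ⟨e + 1 / 2, ⟨by linarith [he.1], by linarith [he.2]⟩, by rwa [hA, inner_neg_neg]⟩
  · obtain ⟨e, he, he'⟩ := h.right δ hδ
    exact ⟨e + 1 / 2, ⟨by linarith [he.1], by linarith [he.2]⟩, by rwa [hA, inner_neg_neg]⟩

theorem inner_T_ne_zero {m u n : E} (B : IsONB m u n) {t : ℝ} (h1 : ⟪L.T t, m⟫ = 0)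
    (h2 : ⟪L.T t, u⟫ = 0) : ⟪L.T t, n⟫ ≠ 0 := by
  intro h3
  have := B.norm_sq_eq (L.T t)
  rw [h1, h2, h3, L.norm_T] at this
  norm_num at this

/-- Every point of the loop near `X t` has a large component along `X t`. -/
theorem exists_lt_inner_X (t : ℝ) (x : E) (hx : L.X t = x) :
    ∃ δ > 0, ∀ τ, |τ - t| < δ → 4 / 5 < ⟪L.X τ, x⟫ := by
  subst hx
  have h : (4 / 5 : ℝ) < ⟪L.X t, L.X t⟫ := by
    rw [real_inner_self_eq_norm_sq, L.norm_X]; norm_num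
  exact Metric.eventually_nhds_iff.1
    ((L.continuous_inner_X (L.X t)).continuousAt.eventually_const_lt h)

/-- The borderline case `r = π / 6`. The loop crosses a great circle orthogonally at the six
vertices of a regular hexagon, of which `X t₂`, `X t₁`, `X s`, `-X t₂` are consecutive. Nearby
points of consecutive strands have distance at least `π / 3`; so at height `h ≠ 0` their longitudes
differ by more than `π / 3`. The strand at `t₂` would therefore have a smaller longitude at height
`h` than at height `-h`, for each small `h ≠ 0` of either sign. -/
theorem false_of_hexagon {c : ℝ} (hc : 0 < c) (hc2 : c ^ 2 = 3 / 4)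
    (hA : ∀ t, L.X (t + 1 / 2) = -L.X t) {m u n : E}
    (B : IsONB m u n) {t₁ t₂ s : ℝ} (hX1 : L.X t₁ = c • m + (1 / 2 : ℝ) • u)
    (hX2 : L.X t₂ = c • m + (-(1 / 2) : ℝ) • u) (hXs : L.X s = (0 : ℝ) • m + (1 : ℝ) • u)
    (hT1 : ⟪L.T t₁, n⟫ ≠ 0) (hT2 : ⟪L.T t₂, n⟫ ≠ 0) (hTs : ⟪L.T s, n⟫ ≠ 0)
    (h21 : ∃ δ > 0, ∀ τ σ, |τ - t₂| < δ → |σ - t₁| < δ → ⟪L.X τ, L.X σ⟫ ≤ 2 * c ^ 2 - 1)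
    (h1s : ∃ δ > 0, ∀ τ σ, |τ - t₁| < δ → |σ - s| < δ → ⟪L.X τ, L.X σ⟫ ≤ 2 * c ^ 2 - 1)
    (h2s : ∃ δ > 0, ∀ τ σ, |τ - (t₂ + 1 / 2)| < δ → |σ - s| < δ →
      ⟪L.X τ, L.X σ⟫ ≤ 2 * c ^ 2 - 1) : False := by
  obtain ⟨δ1, hδ1, h21⟩ := h21
  obtain ⟨δ2, hδ2, h1s⟩ := h1s
  obtain ⟨δ3, hδ3, h2s⟩ := h2s
  obtain ⟨δ4, hδ4, ha2⟩ := L.exists_lt_inner_X t₂ _ hX2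
  obtain ⟨δ5, hδ5, ha1⟩ := L.exists_lt_inner_X t₁ _ hX1
  obtain ⟨δ6, hδ6, has⟩ := L.exists_lt_inner_X s _ hXs
  obtain ⟨δ, hδ0, hδ⟩ := exists_between (show 0 < min (min δ1 (min δ2 δ3)) (min δ4 (min δ5 δ6)) by
    simp only [lt_min_iff]; exact ⟨⟨hδ1, hδ2, hδ3⟩, hδ4, hδ5, hδ6⟩)
  simp only [lt_min_iff] at hδ
  obtain ⟨⟨hδ1, hδ2, hδ3⟩, hδ4, hδ5, hδ6⟩ := hδ
  have hH := L.continuous_inner_X n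
  obtain ⟨η2, hη2, hl2⟩ := (L.signChange_inner (n := n) (t := t₂) (by
    rw [hX2, B.inner_comb_n]) hT2).exists_eq hH hδ0
  obtain ⟨η1, hη1, hl1⟩ := (L.signChange_inner (n := n) (t := t₁) (by
    rw [hX1, B.inner_comb_n]) hT1).exists_eq hH hδ0
  obtain ⟨ηs, hηs, hls⟩ := (L.signChange_inner (n := n) (t := s) (by
    rw [hXs, B.inner_comb_n]) hTs).exists_eq hH hδ0
  obtain ⟨h, hh0, hh⟩ := exists_between (lt_min hη2 (lt_min hη1 hηs))
  simp only [lt_min_iff] at hh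
  have hunit : ∀ τ, ⟪L.X τ, m⟫ ^ 2 + ⟪L.X τ, u⟫ ^ 2 + ⟪L.X τ, n⟫ ^ 2 = 1 := by
    intro τ
    rw [← B.norm_sq_eq, L.norm_X, one_pow]
  -- the comparison of longitudes, at a height `y` of either sign
  have key : ∀ y, |y| = h → ∀ τ σ, |τ - t₂| < δ → ⟪L.X τ, n⟫ = y → |σ - t₂| < δ →
      ⟪L.X σ, n⟫ = -y →
      ⟪L.X τ, (1 / 2 : ℝ) • m + c • u⟫ / ⟪L.X τ, c • m + (-(1 / 2) : ℝ) • u⟫ <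
      ⟪L.X σ, (1 / 2 : ℝ) • m + c • u⟫ / ⟪L.X σ, c • m + (-(1 / 2) : ℝ) • u⟫ := by
    intro y hy τ σ hτ hτy hσ hσy
    have hy0 : y ≠ 0 := by rintro rfl; simp at hy; linarith
    obtain ⟨τ1, hτ1, hτ1y⟩ := hl1 y (by rw [hy]; exact hh.2.1)
    obtain ⟨τs, hτs, hτsy⟩ := hls y (by rw [hy]; exact hh.2.2)
    have i1 := h21 τ τ1 (hτ.trans hδ1) (hτ1.trans hδ1)
    have i2 := h1s τ1 τs (hτ1.trans hδ2) (hτs.trans hδ2)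
    have i3 := h2s (σ + 1 / 2) τs (by rw [add_sub_add_right_eq_sub]; exact hσ.trans hδ3)
      (hτs.trans hδ3)
    have a0 := ha2 τ (hτ.trans hδ4)
    have a1 := ha1 τ1 (hτ1.trans hδ5)
    have a2 := has τs (hτs.trans hδ6)
    have a3 := ha2 σ (hσ.trans hδ4)
    have n0 := hunit τ
    have n1 := hunit τ1
    have n2 := hunit τs
    have n3 := hunit σ
    rw [hτy] at n0
    rw [hτ1y] at n1
    rw [hτsy] at n2
    rw [hσy] at n3
    rw [hA, inner_neg_left] at i3
    rw [B.inner_eq, hτy, hτ1y] at i1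
    rw [B.inner_eq, hτ1y, hτsy] at i2
    rw [B.inner_eq, hσy, hτsy] at i3
    rw [inner_comb] at a0 a1 a2 a3
    rw [inner_comb, inner_comb, inner_comb, inner_comb]
    generalize ⟪L.X τ, m⟫ = x0 at *
    generalize ⟪L.X τ, u⟫ = y0 at *
    generalize ⟪L.X τ1, m⟫ = x1 at *
    generalize ⟪L.X τ1, u⟫ = y1 at *
    generalize ⟪L.X τs, m⟫ = x2 at *
    generalize ⟪L.X τs, u⟫ = y2 at *
    generalize ⟪L.X σ, m⟫ = x3 at *
    generalize ⟪L.X σ, u⟫ = y3 at *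
    have l1 : (x0 * (1 / 2) + y0 * c) / (x0 * c + y0 * -(1 / 2)) <
        (x1 * -(1 / 2) + y1 * c) / (x1 * c + y1 * (1 / 2)) := by
      refine slope_lt_slope (h := y) hc hc2 ?_ ?_ a0 a1 hy0 ?_
      · linear_combination n0 + (x0 ^ 2 + y0 ^ 2) * hc2
      · linear_combination n1 + (x1 ^ 2 + y1 ^ 2) * hc2
      · linear_combination i1 + (2 + x0 * x1 * (3 / 2) + y0 * y1 * (3 / 2) + c * (y0 * x1 - x0 * y1)) * hc2
    have l2 : (x1 * -(1 / 2) + y1 * c) / (x1 * c + y1 * (1 / 2)) <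
        (x2 * -1 + y2 * 0) / (x2 * 0 + y2 * 1) := by
      refine slope_lt_slope (h := y) hc hc2 ?_ ?_ a1 a2 hy0 ?_
      · linear_combination n1 + (x1 ^ 2 + y1 ^ 2) * hc2
      · linear_combination n2
      · linear_combination i2 + (2 + x1 * x2 + y1 * y2) * hc2
    have l3 : (x2 * -1 + y2 * 0) / (x2 * 0 + y2 * 1) <
        (x3 * (1 / 2) + y3 * c) / (x3 * c + y3 * -(1 / 2)) := by
      refine slope_lt_slope (h := y) hc hc2 ?_ ?_ a2 a3 hy0 ?_
      · linear_combination n2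
      · linear_combination n3 + (x3 ^ 2 + y3 ^ 2) * hc2
      · linear_combination i3 + (2 - x3 * x2 - y3 * y2) * hc2
    exact l1.trans (l2.trans l3)
  obtain ⟨τ, hτ, hτy⟩ := hl2 h (by rw [abs_of_pos hh0]; exact hh.1)
  obtain ⟨σ, hσ, hσy⟩ := hl2 (-h) (by rw [abs_neg, abs_of_pos hh0]; exact hh.1)
  have k1 := key h (abs_of_pos hh0) τ σ hτ hτy hσ hσy
  have k2 := key (-h) (by rw [abs_neg, abs_of_pos hh0]) σ τ hσ hσy hτ (by rw [hτy, neg_neg])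
  exact lt_asymm k1 k2

end FramedLoop

namespace FramedLoop

variable {κ : ℝ} {E : Type*} [NormedAddCommGroup E] [InnerProductSpace ℝ E] {L : FramedLoop κ E}

/-! ### Antipodal loops whose band is not simple -/

/-- Planar geometry of caps of radius at least `π / 6`: a point `(A, B)` of the first quadrant of
the unit circle that is not closer to `(1, 0)` than `(c, d)` lies in the cap centred at the
reflection of `(1, 0)` in `(c, d)`. -/
theorem le_of_mem_quadrant {c d A B : ℝ} (hc : 0 < c) (hd : 1 / 2 ≤ d) (hcd : c ^ 2 + d ^ 2 = 1)
    (hA : 0 ≤ A) (hB : 0 ≤ B) (hAB : A ^ 2 + B ^ 2 = 1) (hAc : A < c) :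
    c ≤ A * (2 * c ^ 2 - 1) + B * (2 * c * d) := by
  have hd1 : d < 1 := by nlinarith
  -- the arc of the unit circle lies beyond its chord
  have hBd : d < B := by nlinarith
  have hchord : c ≤ A * (1 - d) + B * c := by
    by_contra! hlt
    have h3 : A * (1 - d) < c * (1 - B) := by linarith
    have h4 : A ^ 2 * (1 - d) ^ 2 < c ^ 2 * (1 - B) ^ 2 := by
      have := pow_lt_pow_left₀ h3 (by apply mul_nonneg hA; linarith) two_ne_zero
      nlinarith
    have h5 : A ^ 2 = (1 - B) * (1 + B) := by linarith
    have h6 : c ^ 2 = (1 - d) * (1 + d) := by linarith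
    have hB1 : B < 1 := by
      by_contra! h
      have : c * (1 - B) ≤ 0 := mul_nonpos_of_nonneg_of_nonpos hc.le (by linarith)
      have : 0 ≤ A * (1 - d) := mul_nonneg hA (by linarith)
      linarith
    have h7 : 0 < (1 - B) * (1 - d) := mul_pos (by linarith) (by linarith)
    have h8 : (1 - B) * (1 - d) * ((1 + B) * (1 - d)) < (1 - B) * (1 - d) * ((1 + d) * (1 - B)) := by
      rw [h5, h6] at h4
      nlinarith
    have h9 := lt_of_mul_lt_mul_left h8 h7.le
    nlinarith
  have hw : 0 ≤ B * c - A * d := by nlinarith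
  nlinarith

/-- Three great-circle crossings are incompatible: if the cap centred at `m` touches the loop at the
two opposite points `X t₁`, `X t₂` of its boundary, then the loop does not meet the great circle
through them at a third time (up to the antipodal symmetry). -/
theorem false_of_crossing {c d : ℝ} (hc : 0 < c) (hd : 1 / 2 ≤ d) (hcd : c ^ 2 + d ^ 2 = 1)
    (hκ : κ * d ≤ c) (hW : ¬ L.TwoPeaks c) (hA : ∀ t, L.X (t + 1 / 2) = -L.X t) {m u n : E}
    (B : IsONB m u n) {t₁ t₂ s : ℝ} (hX1 : L.X t₁ = c • m + d • u)
    (hX2 : L.X t₂ = c • m + (-d) • u)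
    (hT1m : ⟪L.T t₁, m⟫ = 0) (hT1u : ⟪L.T t₁, u⟫ = 0)
    (hT2m : ⟪L.T t₂, m⟫ = 0) (hT2u : ⟪L.T t₂, u⟫ = 0)
    (hsn : ⟪L.X s, n⟫ = 0) (hsm : 0 ≤ ⟪L.X s, m⟫) (hsu : 0 ≤ ⟪L.X s, u⟫)
    (hs1 : ∀ k : ℤ, s ≠ t₁ + k / 2) (hs2 : ∀ k : ℤ, s ≠ t₂ + k / 2) : False := by
  have hd0 : 0 < d := by linarith
  have hc1 : c < 1 := by nlinarith
  have hs1' : ∀ k : ℤ, s ≠ t₁ + k := fun k h => hs1 (2 * k) (by push_cast; linarith)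
  have hs2' : ∀ k : ℤ, s ≠ t₂ + k := fun k h => hs2 (2 * k) (by push_cast; linarith)
  have hs2'' : ∀ k : ℤ, s ≠ t₂ + 1 / 2 + k := fun k h => hs2 (2 * k + 1) (by push_cast; linarith)
  have hp1 : L.IsPeak c m t₁ := L.isPeak hc hd0 hcd hκ B.norm_m (by rw [hX1, B.inner_comb_m]) hT1m
  have hp2 : L.IsPeak c m t₂ := L.isPeak hc hd0 hcd hκ B.norm_m (by rw [hX2, B.inner_comb_m]) hT2m
  have hXs : L.X s = ⟪L.X s, m⟫ • m + ⟪L.X s, u⟫ • u := by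
    conv_lhs => rw [B.expand (L.X s), hsn, zero_smul, add_zero]
  obtain ⟨a, ha⟩ : ∃ a, a = ⟪L.X s, m⟫ := ⟨_, rfl⟩
  obtain ⟨b, hb⟩ : ∃ b, b = ⟪L.X s, u⟫ := ⟨_, rfl⟩
  rw [← ha] at hXs hsm
  rw [← hb] at hXs hsu
  have hab : a ^ 2 + b ^ 2 = 1 := by
    have := B.norm_sq_eq (L.X s)
    rw [hsn, L.norm_X, ← ha, ← hb] at this
    linarith
  -- the point `X s` is outside the cap centred at `m`
  have hac : a < c := by
    by_contra! hle
    rw [ha] at hle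
    have e1 := (hp1.add_eq hc hc1 hW B.norm_m hle hs1').2
    have e2 := (hp2.add_eq hc hc1 hW B.norm_m hle hs2').2
    have : L.X t₁ = L.X t₂ := add_right_cancel (e1.trans e2.symm)
    have := congrArg (fun x => ⟪x, u⟫) this
    simp only [hX1, hX2, B.inner_comb_u] at this
    linarith
  -- hence it is in the cap that touches the loop at `X t₁` from the other side
  have hm1n : (2 * c ^ 2 - 1) ^ 2 + (2 * c * d) ^ 2 = 1 := by
    linear_combination (4 * c ^ 2) * hcd
  obtain ⟨m₁, hm1⟩ : ∃ m₁, m₁ = (2 * c ^ 2 - 1) • m + (2 * c * d) • u := ⟨_, rfl⟩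
  have hm1' : ‖m₁‖ = 1 := by rw [hm1, B.norm_comb hm1n]
  have hp1' : L.IsPeak c m₁ t₁ := by
    refine L.isPeak hc hd0 hcd hκ hm1' ?_ ?_
    · rw [hm1, inner_comb, hX1, B.inner_comb_m, B.inner_comb_u]
      linear_combination (2 * c) * hcd
    · rw [hm1, inner_comb, hT1m, hT1u]; ring
  have hs1m : c ≤ ⟪L.X s, m₁⟫ := by
    rw [hm1, inner_comb, ← ha, ← hb]
    exact le_of_mem_quadrant hc hd hcd hsm hsu hab hac
  obtain ⟨hs1c, hsum1⟩ := hp1'.add_eq hc hc1 hW hm1' hs1m hs1'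
  -- so `X s` is opposite to `X t₁`, at angle `3 r ≤ π / 2` from `m`
  have ea : c + a = 2 * c * (2 * c ^ 2 - 1) := by
    have := congrArg (fun x => ⟪x, m⟫) hsum1
    simp only [inner_add_left, hX1, hXs, inner_smul_left, hm1, B.inner_comb_m] at this
    simpa using this
  have hc2 : c ^ 2 = 3 / 4 := by
    have h1 : 0 ≤ c * (4 * c ^ 2 - 3) := by linarith
    have h2 : 0 ≤ 4 * c ^ 2 - 3 := by
      by_contra! hlt
      exact absurd h1 (not_le.2 (mul_neg_of_pos_of_neg hc hlt))
    nlinarith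
  have hd2 : d = 1 / 2 := by nlinarith
  have ha0 : a = 0 := by linear_combination ea + 4 * c * hc2
  have hb1 : b = 1 := by
    rw [ha0] at hab
    nlinarith
  subst hd2
  rw [ha0, hb1] at hXs
  -- the six crossings now form a regular hexagon
  have hp2' : L.IsPeak c (-m₁ + (4 * c * (1 / 2)) • u) (t₂ + 1 / 2) := by
    have h3 : L.IsPeak c (m₁ - (4 * c * (1 / 2)) • u) t₂ := by
      have e : m₁ - (4 * c * (1 / 2)) • u = (2 * c ^ 2 - 1) • m + (-(2 * c * (1 / 2))) • u := by
        rw [hm1]; module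
      rw [e]
      refine L.isPeak hc hd0 hcd hκ (B.norm_comb (by rw [neg_sq]; exact hm1n)) ?_ ?_
      · rw [inner_comb, hX2, B.inner_comb_m, B.inner_comb_u]
        linear_combination (2 * c) * hcd
      · rw [inner_comb, hT2m, hT2u]; ring
    have := h3.add_half hA
    rwa [neg_sub', sub_neg_eq_add] at this
  have hm3 : -m₁ + (4 * c * (1 / 2)) • u = (1 - 2 * c ^ 2) • m + (2 * c * (1 / 2)) • u := by
    rw [hm1]; module
  rw [hm3] at hp2'
  have hm3' : ‖(1 - 2 * c ^ 2) • m + (2 * c * (1 / 2)) • u‖ = 1 :=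
    B.norm_comb (by linear_combination hm1n)
  have hsum3 : L.X (t₂ + 1 / 2) + L.X s =
      (2 * c) • ((1 - 2 * c ^ 2) • m + (2 * c * (1 / 2)) • u) := by
    have e1 : (2 * c) * (1 - 2 * c ^ 2) = -c := by linear_combination (-4 * c) * hc2
    have e2 : (2 * c) * (2 * c * (1 / 2)) = 3 / 2 := by linear_combination 2 * hc2
    rw [hA, hX2, hXs, smul_add, smul_smul, smul_smul, e1, e2]
    module
  have hTs1 : ⟪L.T s, m₁⟫ = 0 := by
    refine L.inner_T_eq_zero_of_isMax (a := s - 1) (b := s + 1) (by linarith) (by linarith)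
      (fun τ _ => ?_)
    rw [hs1c]
    by_cases hτ : ∀ k : ℤ, τ ≠ t₁ + k
    · by_contra! hlt
      exact hlt.ne' (hp1'.add_eq hc hc1 hW hm1' hlt.le hτ).1
    · push Not at hτ
      obtain ⟨k, rfl⟩ := hτ
      rw [L.X_add_int, hp1'.inner_eq]
  have hTsu : ⟪L.T s, u⟫ = 0 := by
    have := L.inner_X_T s
    rw [real_inner_comm, hXs, inner_comb] at this
    linarith
  have hTsm : ⟪L.T s, m⟫ = 0 := by
    rw [hm1, inner_comb, hTsu, hc2] at hTs1
    linarith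
  have h21 : ∀ k : ℤ, t₁ ≠ t₂ + k := by
    intro k hk
    have := L.X_add_int t₂ k
    rw [← hk, hX1, hX2] at this
    have := congrArg (fun x => ⟪x, u⟫) this
    simp only [B.inner_comb_u] at this
    linarith
  refine false_of_hexagon hc hc2 hA B hX1 hX2 hXs (inner_T_ne_zero B hT1m hT1u)
    (inner_T_ne_zero B hT2m hT2u) (inner_T_ne_zero B hTsm hTsu)
    (hp2.eventually_inner_le hc hW B.norm_m ?_ h21)
    (hp1'.eventually_inner_le hc hW hm1' hsum1 hs1')
    (hp2'.eventually_inner_le hc hW hm3' hsum3 hs2'')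
  rw [hX1, hX2]
  module

theorem SignChange.sub_half {H : ℝ → ℝ} (hanti : ∀ t, H (t + 1 / 2) = -H t) {t : ℝ}
    (h : SignChange H t) : SignChange H (t - 1 / 2) := by
  obtain ⟨δ, hδ, hs⟩ := h
  refine ⟨δ, hδ, fun x hx y hy => ?_⟩
  have := hs (x + 1 / 2) ⟨by linarith [hx.1], by linarith [hx.2]⟩ (y + 1 / 2)
    ⟨by linarith [hy.1], by linarith [hy.2]⟩
  rwa [hanti, hanti, neg_mul_neg] at this

/-- If a cap touches an antipodal loop without two separate peaks at two opposite points `X t₁`,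
`X t₂` of its boundary, parity provides a third crossing of the great circle through these points,
which is impossible. -/
theorem false_of_opposite {c d : ℝ} (hc : 0 < c) (hd : 1 / 2 ≤ d) (hcd : c ^ 2 + d ^ 2 = 1)
    (hκ : κ * d ≤ c) (hW : ¬ L.TwoPeaks c) (hA : ∀ t, L.X (t + 1 / 2) = -L.X t) {m u n : E}
    (B : IsONB m u n) {t₁ t₂ : ℝ} (h12 : t₁ < t₂) (h21 : t₂ < t₁ + 1)
    (hX1 : L.X t₁ = c • m + d • u) (hX2 : L.X t₂ = c • m + (-d) • u)
    (hT1m : ⟪L.T t₁, m⟫ = 0) (hT1u : ⟪L.T t₁, u⟫ = 0)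
    (hT2m : ⟪L.T t₂, m⟫ = 0) (hT2u : ⟪L.T t₂, u⟫ = 0) : False := by
  have hanti : ∀ t, ⟪L.X (t + 1 / 2), n⟫ = -⟪L.X t, n⟫ := fun t => by rw [hA, inner_neg_left]
  have hH := L.continuous_inner_X n
  have hc1 := L.signChange_inner (n := n) (t := t₁) (by rw [hX1, B.inner_comb_n])
    (inner_T_ne_zero B hT1m hT1u)
  have hc2 := L.signChange_inner (n := n) (t := t₂) (by rw [hX2, B.inner_comb_n])
    (inner_T_ne_zero B hT2m hT2u)
  have hex : ∃ s ∈ Ioo t₁ (t₁ + 1 / 2), (∀ k : ℤ, s ≠ t₂ + k / 2) ∧ ⟪L.X s, n⟫ = 0 := by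
    have aux : ∀ b, t₁ < b → b < t₁ + 1 / 2 → (∃ j : ℤ, b = t₂ + j / 2) →
        SignChange (fun τ => ⟪L.X τ, n⟫) b →
        ∃ s ∈ Ioo t₁ (t₁ + 1 / 2), (∀ k : ℤ, s ≠ t₂ + k / 2) ∧ ⟪L.X s, n⟫ = 0 := by
      rintro b hb1 hb2 ⟨j, hj⟩ hcb
      obtain ⟨s, hs, hsb, hs0⟩ := exists_third_zero hH hanti hb1 hb2 hc1 hcb
      refine ⟨s, hs, fun k hk => hsb ?_, hs0⟩
      have h1 : ((k - j : ℤ) : ℝ) < 1 := by push_cast; linarith [hs.2]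
      have h2 : (-1 : ℝ) < ((k - j : ℤ) : ℝ) := by push_cast; linarith [hs.1]
      have h3 : k - j < 1 := by exact_mod_cast h1
      have h4 : -1 < k - j := by exact_mod_cast h2
      obtain rfl : k = j := by omega
      rw [hk, hj]
    rcases lt_trichotomy t₂ (t₁ + 1 / 2) with h | h | h
    · exact aux t₂ h12 h ⟨0, by simp⟩ hc2
    · exfalso
      have := hA t₁
      rw [← h, hX1, hX2] at this
      have := congrArg (fun x => ⟪x, m⟫) this
      simp only [inner_neg_left, B.inner_comb_m] at this
      linarith
    · exact aux (t₂ - 1 / 2) (by linarith) (by linarith) ⟨-1, by push_cast; ring⟩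
        (hc2.sub_half hanti)
  obtain ⟨s, hs, hs2, hs0⟩ := hex
  have hs1 : ∀ k : ℤ, s ≠ t₁ + k / 2 := by
    intro k hk
    have h1 : (k : ℝ) < 1 := by linarith [hs.2]
    have h2 : (0 : ℝ) < k := by linarith [hs.1]
    have h3 : k < 1 := by exact_mod_cast h1
    have h4 : 0 < k := by exact_mod_cast h2
    omega
  -- by symmetry, `X s` may be taken in the quadrant spanned by `m` and `u`
  have main : ∀ s, (∀ k : ℤ, s ≠ t₁ + k / 2) → (∀ k : ℤ, s ≠ t₂ + k / 2) → ⟪L.X s, n⟫ = 0 →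
      0 ≤ ⟪L.X s, m⟫ → False := by
    intro s hs1 hs2 hs0 hsm
    rcases le_total 0 ⟪L.X s, u⟫ with hsu | hsu
    · exact false_of_crossing hc hd hcd hκ hW hA B hX1 hX2 hT1m hT1u hT2m hT2u hs0 hsm hsu hs1 hs2
    · refine false_of_crossing hc hd hcd hκ hW hA B.neg_u (t₁ := t₂) (t₂ := t₁) (s := s) ?_ ?_ hT2m
        ?_ hT1m ?_ hs0 hsm ?_ hs2 hs1
      · rw [hX2]; module
      · rw [hX1]; module
      · rw [inner_neg_right, hT2u, neg_zero]
      · rw [inner_neg_right, hT1u, neg_zero]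
      · rw [inner_neg_right]; linarith
  rcases le_total 0 ⟪L.X s, m⟫ with hsm | hsm
  · exact main s hs1 hs2 hs0 hsm
  · refine main (s + 1 / 2) (fun k hk => hs1 (k - 1) ?_) (fun k hk => hs2 (k - 1) ?_) ?_ ?_
    · push_cast; linarith
    · push_cast; linarith
    · rw [hanti, hs0, neg_zero]
    · rw [hA, inner_neg_left]; linarith

/-- The two preimages of a double point of the band belong to different times, since for a fixed
time the band is an arc of a great circle shorter than `π`. -/
theorem exists_of_not_simple {r : ℝ} (hr : r < π / 2) (h : ¬ L.Simple r) :
    ∃ (t₁ t₂ θ₁ θ₂ : ℝ), 0 ≤ t₁ ∧ t₁ < t₂ ∧ t₂ < 1 ∧ θ₁ ∈ Icc (-r) r ∧ θ₂ ∈ Icc (-r) r ∧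
      L.band t₁ θ₁ = L.band t₂ θ₂ := by
  simp only [Simple, InjOn, not_forall] at h
  obtain ⟨⟨t, θ⟩, ⟨ht, hθ⟩, ⟨s, φ⟩, ⟨hs, hφ⟩, heq, hne⟩ := h
  simp only at ht hθ hs hφ heq
  rcases lt_trichotomy t s with hts | rfl | hts
  · exact ⟨t, s, θ, φ, ht.1, hts, hs.2, hθ, hφ, heq⟩
  · refine absurd ?_ hne
    have h1 := L.inner_N_band t θ
    rw [heq, L.inner_N_band] at h1
    rw [injOn_sin ⟨by linarith [hφ.1], by linarith [hφ.2]⟩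
      ⟨by linarith [hθ.1], by linarith [hθ.2]⟩ h1]
  · exact ⟨s, t, φ, θ, hs.1, hts, ht.2, hφ, hθ, heq.symm⟩

/-- For an antipodal loop and half-widths `r ≥ π / 6`, a failure of simplicity of the closed band
is always caused by an overlap of open bands. -/
theorem twoPeaks_of_not_simple {r : ℝ} (hr0 : π / 6 ≤ r) (hr : r < π / 2)
    (hκ : κ * sin r ≤ cos r) (hA : ∀ t, L.X (t + 1 / 2) = -L.X t) (h : ¬ L.Simple r) :
    L.TwoPeaks (cos r) := by
  by_contra hW
  obtain ⟨t₁, t₂, θ₁, θ₂, h0, h12, h21, hθ1, hθ2, heq⟩ := exists_of_not_simple hr h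
  have hc : 0 < cos r := cos_pos_of_mem_Ioo ⟨by linarith [pi_pos], hr⟩
  have hd : 1 / 2 ≤ sin r := by
    rw [← sin_pi_div_six]
    exact sin_le_sin_of_le_of_le_pi_div_two (by linarith [pi_pos]) hr.le hr0
  have hcd := cos_sq_add_sin_sq r
  have hd0 : 0 < sin r := by linarith
  have hc1 : cos r < 1 := by nlinarith
  have hcos : ∀ θ ∈ Icc (-r) r, cos r ≤ cos θ := fun θ hθ => by
    rw [← cos_abs θ]
    exact cos_le_cos_of_nonneg_of_le_pi (abs_nonneg θ) (by linarith) (abs_le.2 hθ)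
  obtain ⟨m, hm⟩ : ∃ m, m = L.band t₁ θ₁ := ⟨_, rfl⟩
  have hm' : m = L.band t₂ θ₂ := hm.trans heq
  have hmn : ‖m‖ = 1 := by rw [hm, L.norm_band]
  have hx1 : ⟪L.X t₁, m⟫ = cos θ₁ := by rw [hm, L.inner_X_band]
  have hx2 : ⟪L.X t₂, m⟫ = cos θ₂ := by rw [hm', L.inner_X_band]
  have hT1 : ⟪L.T t₁, m⟫ = 0 := by rw [hm, L.inner_T_band]
  have hT2 : ⟪L.T t₂, m⟫ = 0 := by rw [hm', L.inner_T_band]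
  obtain ⟨e₂, he2, he2'⟩ := L.exists_inner_lt_of_inner_T_le hc hd0 hcd hκ hmn h12
    (by rw [hT1, hT2])
  obtain ⟨e₁, he1, he1'⟩ := L.exists_inner_lt_of_inner_T_le hc hd0 hcd hκ hmn
    (show t₂ < t₁ + 1 by linarith) (by rw [L.periodic_T, hT1, hT2])
  have hX1' : cos r ≤ ⟪L.X t₁, m⟫ := hx1 ▸ hcos θ₁ hθ1
  have hX2' : cos r ≤ ⟪L.X t₂, m⟫ := hx2 ▸ hcos θ₂ hθ2
  obtain ⟨hf2, hsum⟩ := L.add_eq_of_not_twoPeaks hc hc1 hW hmn (e₁ := e₁ - 1) (by linarith [he1.2])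
    he2.1 he2.2 (by linarith [he1.1]) (by rwa [L.periodic_X.sub_eq]) hX1' he2' hX2'
  have hf1 : ⟪L.X t₁, m⟫ = cos r := by
    have := congrArg (fun x => ⟪x, m⟫) hsum
    simp only [inner_add_left, inner_smul_left, hf2, real_inner_self_eq_norm_sq, hmn] at this
    simp only [conj_trivial] at this
    linarith
  -- an orthonormal basis adapted to the great circle through `X t₁`, `m` and `X t₂`
  obtain ⟨u, hu⟩ : ∃ u, u = (sin r)⁻¹ • (L.X t₁ - cos r • m) := ⟨_, rfl⟩
  have hX1 : L.X t₁ = cos r • m + sin r • u := by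
    rw [hu, smul_smul, mul_inv_cancel₀ hd0.ne', one_smul]; module
  have hX2 : L.X t₂ = cos r • m + (-sin r) • u := by
    have : L.X t₂ = (2 * cos r) • m - L.X t₁ := by rw [← hsum]; module
    rw [this, hX1]; module
  have hu' : ∀ x, ⟪x, u⟫ = (sin r)⁻¹ * (⟪x, L.X t₁⟫ - cos r * ⟪x, m⟫) := fun x => by
    rw [hu, inner_smul_right, inner_sub_right, inner_smul_right]
  have hT1u : ⟪L.T t₁, u⟫ = 0 := by
    rw [hu', hT1, real_inner_comm, L.inner_X_T]; ring
  have hT2u : ⟪L.T t₂, u⟫ = 0 := by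
    have h1 := L.inner_X_T t₂
    rw [real_inner_comm, hX2, inner_comb, hT2] at h1
    have : ⟪L.T t₂, u⟫ * sin r = 0 := by linarith
    exact (mul_eq_zero.1 this).resolve_right hd0.ne'
  have hmu : ⟪m, u⟫ = 0 := by
    rw [hu', real_inner_comm, hf1, real_inner_self_eq_norm_sq, hmn]; ring
  have hun : ‖u‖ = 1 := by
    have h1 : ‖L.X t₁‖ ^ 2 = cos r ^ 2 + sin r ^ 2 * ‖u‖ ^ 2 := by
      rw [hX1, norm_add_sq_real, norm_smul, norm_smul, hmn, inner_smul_left, inner_smul_right, hmu,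
        mul_pow, mul_pow, Real.norm_eq_abs, Real.norm_eq_abs, sq_abs, sq_abs]
      ring
    rw [L.norm_X] at h1
    have h2 : sin r ^ 2 * (‖u‖ ^ 2 - 1) = 0 := by linear_combination -h1 - hcd
    have h3 := (mul_eq_zero.1 h2).resolve_left (by positivity)
    nlinarith [norm_nonneg u]
  have hs1 : sin θ₁ ^ 2 = sin r ^ 2 := by
    have := cos_sq_add_sin_sq θ₁
    rw [← hx1, hf1] at this
    linarith
  have hpars : ∀ x, ⟪x, m⟫ ^ 2 + ⟪x, u⟫ ^ 2 + ⟪x, L.T t₁⟫ ^ 2 = ‖x‖ ^ 2 := by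
    intro x
    have h1 := L.parseval t₁ x
    have h2 : ⟪x, m⟫ = cos r * ⟪L.X t₁, x⟫ + sin θ₁ * ⟪L.N t₁, x⟫ := by
      rw [hm, band, inner_comb, ← hx1, hf1, real_inner_comm, real_inner_comm (L.N t₁)]; ring
    have h3 : sin r * ⟪x, u⟫ = ⟪L.X t₁, x⟫ - cos r * ⟪x, m⟫ := by
      rw [hu', ← mul_assoc, mul_inv_cancel₀ hd0.ne', one_mul, real_inner_comm x]
    rw [real_inner_comm (L.T t₁)]
    have h4 : sin r ^ 2 * (⟪x, m⟫ ^ 2 + ⟪x, u⟫ ^ 2 + ⟪L.T t₁, x⟫ ^ 2 - ‖x‖ ^ 2) = 0 := by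
      rw [h2] at h3 ⊢
      generalize ⟪L.X t₁, x⟫ = P at *
      generalize ⟪L.N t₁, x⟫ = Q at *
      linear_combination (sin r * ⟪x, u⟫ + P - cos r * (cos r * P + sin θ₁ * Q)) * h3 +
        ((cos r * P + sin θ₁ * Q) ^ 2 - P ^ 2) * hcd + Q ^ 2 * hs1 + sin r ^ 2 * h1
    have h5 := (mul_eq_zero.1 h4).resolve_left (by positivity)
    linarith
  have B : IsONB m u (L.T t₁) :=
    { norm_m := hmn
      norm_u := hun
      norm_n := L.norm_T t₁
      inner_m_u := hmu
      inner_m_n := by rw [real_inner_comm, hT1]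
      inner_u_n := by rw [real_inner_comm, hT1u]
      expand := fun x => by
        refine sub_eq_zero.1 (norm_eq_zero.1 (pow_eq_zero_iff two_ne_zero |>.1 ?_))
        rw [← hpars]
        simp only [inner_sub_left, inner_add_left, inner_smul_left, conj_trivial,
          real_inner_self_eq_norm_sq, hmn, hun, L.norm_T, hmu, hT1, hT1u, real_inner_comm m u,
          real_inner_comm (L.T t₁) m, real_inner_comm (L.T t₁) u]
        ring }
  exact false_of_opposite hc hd hcd hκ hW hA B h12 (by linarith) hX1 hX2 hT1 hT1u hT2 hT2u

end FramedLoop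

namespace FramedLoop

variable {κ : ℝ} {E : Type*} [NormedAddCommGroup E] [InnerProductSpace ℝ E] {L : FramedLoop κ E}

/-! ### Stability of simple bands -/

/-- As long as the tangent makes an acute angle with `T t`, all the curves `band · φ` with
`|φ| ≤ arccot κ` move strictly forward in the direction `T t`; so the band cannot return to the
great circle orthogonal to the loop at `X t`. -/
theorem band_ne_band {r : ℝ} (hr0 : 0 < r) (hr : r < π / 2) (hκ : κ * sin r ≤ cos r) {t s : ℝ}
    (hts : t < s) (hT : ∀ τ ∈ Ioo t s, 0 < ⟪L.T τ, L.T t⟫) (θ : ℝ) {φ : ℝ}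
    (hφ : φ ∈ Icc (-r) r) : L.band t θ ≠ L.band s φ := by
  intro heq
  have hsin : |sin φ| ≤ sin r := by
    rw [abs_le, ← sin_neg]
    exact ⟨sin_le_sin_of_le_of_le_pi_div_two (by linarith) (by linarith [hφ.2]) hφ.1,
      sin_le_sin_of_le_of_le_pi_div_two (by linarith [hφ.1]) (by linarith) hφ.2⟩
  have hcos : cos r ≤ cos φ := by
    rw [← cos_abs φ]
    exact cos_le_cos_of_nonneg_of_le_pi (abs_nonneg φ) (by linarith) (abs_le.2 hφ)
  have hs0 : 0 < sin r := sin_pos_of_pos_of_lt_pi hr0 (by linarith)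
  have hpos : ∀ τ, 0 < cos φ - L.k τ * sin φ := by
    intro τ
    have : L.k τ * sin φ < cos r := by
      calc L.k τ * sin φ ≤ |L.k τ| * |sin φ| := by rw [← abs_mul]; exact le_abs_self _
        _ ≤ |L.k τ| * sin r := by gcongr
        _ < κ * sin r := by gcongr; exact L.abs_k_lt τ
        _ ≤ cos r := hκ
    linarith
  have hint := ((L.integrable_X' (L.T t) t s).const_mul (cos φ)).add
    ((L.integrable_N' (L.T t) t s).const_mul (sin φ))
  have h1 := intervalIntegral.intervalIntegral_pos_of_pos_on hint (fun τ hτ => by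
    have := mul_pos (L.v_pos τ) (mul_pos (hpos τ) (hT τ hτ))
    linarith) hts
  rw [intervalIntegral.integral_add ((L.integrable_X' (L.T t) t s).const_mul (cos φ))
    ((L.integrable_N' (L.T t) t s).const_mul (sin φ)), intervalIntegral.integral_const_mul,
    intervalIntegral.integral_const_mul, ← L.X_sub, ← L.N_sub] at h1
  have h2 := L.inner_T_band t θ
  have h3 := L.inner_T_band t φ
  rw [heq] at h2
  rw [band, inner_comb, real_inner_comm, real_inner_comm (L.N _)] at h2 h3
  linarith

/-- Simplicity of the closed band is an open condition: nearby in time, double points are excluded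
by `band_ne_band`, uniformly in the loop, and far apart by compactness. -/
theorem Simple.exists_stable {r : ℝ} (hr0 : 0 < r) (hr : r < π / 2) (hκ : κ * sin r ≤ cos r)
    (h : L.Simple r) : ∃ ε > 0, ∀ L' : FramedLoop κ E, (∀ t, ‖L'.X t - L.X t‖ < ε) →
      (∀ t, ‖L'.T t - L.T t‖ < ε) → (∀ t, ‖L'.N t - L.N t‖ < ε) → L'.Simple r := by
  obtain ⟨δ, hδ, hunif⟩ := Metric.uniformContinuousOn_iff.1
    ((isCompact_Icc (a := (0 : ℝ)) (b := 2)).uniformContinuousOn_of_continuous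
      L.continuous_T.continuousOn) (1 / 4) (by norm_num)
  let K : Set ((ℝ × ℝ) × ℝ × ℝ) := ((Icc 0 1 ×ˢ Icc 0 1) ×ˢ (Icc (-r) r ×ˢ Icc (-r) r)) ∩
    {p | δ ≤ p.1.2 - p.1.1 ∧ p.1.2 - p.1.1 ≤ 1 - δ}
  have hK : IsCompact K := by
    refine ((isCompact_Icc.prod isCompact_Icc).prod
      (isCompact_Icc.prod isCompact_Icc)).inter_right ?_
    have hd : Continuous fun p : (ℝ × ℝ) × ℝ × ℝ => p.1.2 - p.1.1 := by fun_prop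
    exact (isClosed_le continuous_const hd).inter (isClosed_le hd continuous_const)
  have hXc := L.continuous_X
  have hNc := L.continuous_N
  have hcont : Continuous fun p : (ℝ × ℝ) × ℝ × ℝ =>
      ‖L.band p.1.1 p.2.1 - L.band p.1.2 p.2.2‖ := by
    unfold band
    fun_prop
  obtain ⟨η, hη, hηK⟩ := hK.exists_forall_le' hcont.continuousOn (a := 0) (by
    rintro ⟨⟨t, s⟩, θ, φ⟩ ⟨⟨⟨ht, hs⟩, hθ, hφ⟩, hδ1, hδ2⟩
    simp only at ht hs hθ hφ hδ1 hδ2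
    refine norm_pos_iff.2 (sub_ne_zero.2 fun heq => ?_)
    simp only at heq
    rcases hs.2.lt_or_eq with hs1 | rfl
    · have := @h (t, θ) ⟨⟨ht.1, by linarith⟩, hθ⟩ (s, φ) ⟨⟨hs.1, hs1⟩, hφ⟩ heq
      have : t = s := congrArg Prod.fst this
      linarith
    · have h0 : L.band 1 φ = L.band 0 φ := by simpa using L.periodic_band φ 0
      rw [h0] at heq
      have := @h (t, θ) ⟨⟨ht.1, by linarith⟩, hθ⟩ (0, φ) ⟨⟨le_rfl, one_pos⟩, hφ⟩ heq
      have : t = 0 := congrArg Prod.fst this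
      linarith)
  refine ⟨min (1 / 4) (η / 4), lt_min (by norm_num) (by linarith), fun L' hX hT hN => ?_⟩
  by_contra hns
  obtain ⟨t, s, θ, φ, ht, hts, hs, hθ, hφ, heq⟩ := exists_of_not_simple hr hns
  have hacute : ∀ x ∈ Icc (0 : ℝ) 2, ∀ y ∈ Icc (0 : ℝ) 2, dist x y < δ →
      0 < ⟪L'.T x, L'.T y⟫ := by
    intro x hx y hy hxy
    have h1 := hunif x hx y hy hxy
    rw [dist_eq_norm] at h1
    have h2 := (hT x).trans_le (min_le_left _ _)
    have h3 := (hT y).trans_le (min_le_left _ _)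
    have h4 : ‖L'.T x - L'.T y‖ ≤ ‖L'.T x - L.T x‖ + ‖L.T x - L.T y‖ + ‖L'.T y - L.T y‖ := by
      have e : L'.T x - L'.T y = (L'.T x - L.T x) + (L.T x - L.T y) - (L'.T y - L.T y) := by abel
      rw [e]
      exact (norm_sub_le _ _).trans (by gcongr; exact norm_add_le _ _)
    have h5 : ‖L'.T x - L'.T y‖ < 3 / 4 := by linarith
    have h6 := norm_sub_sq_real (L'.T x) (L'.T y)
    rw [L'.norm_T, L'.norm_T] at h6
    nlinarith [norm_nonneg (L'.T x - L'.T y)]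
  rcases lt_or_ge (s - t) δ with hd | hd
  · refine band_ne_band hr0 hr hκ hts (fun τ hτ => hacute τ ?_ t ?_ ?_) θ hφ heq
    · exact ⟨by linarith [hτ.1], by linarith [hτ.2]⟩
    · exact ⟨ht, by linarith⟩
    · rw [Real.dist_eq, abs_of_pos (by linarith [hτ.1])]
      linarith [hτ.2]
  rcases le_or_gt (s - t) (1 - δ) with hd' | hd'
  · have h1 := hηK ((t, s), θ, φ) ⟨⟨⟨⟨ht, by linarith⟩, ⟨by linarith, hs.le⟩⟩, hθ, hφ⟩, hd, hd'⟩
    simp only at h1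
    have hb : ∀ x y, ‖L'.band x y - L.band x y‖ < η / 2 := by
      intro x y
      have e : L'.band x y - L.band x y =
          cos y • (L'.X x - L.X x) + sin y • (L'.N x - L.N x) := by
        simp only [band]; module
      rw [e]
      refine (norm_add_le _ _).trans_lt ?_
      rw [norm_smul, norm_smul, Real.norm_eq_abs, Real.norm_eq_abs]
      have h2 := (hX x).trans_le (min_le_right _ _)
      have h3 := (hN x).trans_le (min_le_right _ _)
      have h4 := mul_le_of_le_one_left (norm_nonneg (L'.X x - L.X x)) (abs_cos_le_one y)
      have h5 := mul_le_of_le_one_left (norm_nonneg (L'.N x - L.N x)) (abs_sin_le_one y)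
      linarith
    have e : L.band t θ - L.band s φ =
        (L'.band s φ - L.band s φ) - (L'.band t θ - L.band t θ) := by
      rw [heq]; abel
    rw [e] at h1
    have h2 := norm_sub_le (L'.band s φ - L.band s φ) (L'.band t θ - L.band t θ)
    linarith [hb s φ, hb t θ]
  · refine band_ne_band hr0 hr hκ (show s < t + 1 by linarith)
      (fun τ hτ => hacute τ ?_ s ?_ ?_) φ hθ ?_
    · exact ⟨by linarith [hτ.1], by linarith [hτ.2]⟩
    · exact ⟨by linarith, by linarith⟩
    · rw [Real.dist_eq, abs_of_pos (by linarith [hτ.1])]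
      linarith [hτ.2]
    · rw [← heq]
      exact (L'.periodic_band θ t).symm

end FramedLoop

/-! ### The charts are Lipschitz -/

theorem abs_speedOf_sub_le (s t : ℝ) : |speedOf s - speedOf t| ≤ |s - t| := by
  have hs := speedOf_pos s
  have ht := speedOf_pos t
  have h : s - t = (speedOf s - speedOf t) * (1 + (speedOf s)⁻¹ * (speedOf t)⁻¹) := by
    conv_lhs => rw [← speedChart_speedOf s, ← speedChart_speedOf t]
    unfold speedChart
    field_simp
    ring
  rw [h, abs_mul]
  refine le_mul_of_one_le_right (abs_nonneg _) ?_
  have : 0 < (speedOf s)⁻¹ * (speedOf t)⁻¹ := by positivity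
  rw [abs_of_pos (by linarith)]
  linarith

theorem abs_curvatureOf_sub_le {κ : ℝ} (hκ : 0 < κ) (s t : ℝ) :
    |curvatureOf (-κ) κ s - curvatureOf (-κ) κ t| ≤ 2 * κ ^ 2 * |s - t| := by
  have hlt : -κ < κ := by linarith
  obtain ⟨hs1, hs2⟩ := curvatureOf_mem hlt s
  obtain ⟨ht1, ht2⟩ := curvatureOf_mem hlt t
  have es := curvatureChart_curvatureOf hlt s
  have et := curvatureChart_curvatureOf hlt t
  generalize curvatureOf (-κ) κ s = x at *
  generalize curvatureOf (-κ) κ t = y at *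
  have h1 : 0 < (κ + x) * (κ + y) := mul_pos (by linarith) (by linarith)
  have h2 : 0 < (κ - x) * (κ - y) := mul_pos (by linarith) (by linarith)
  have n1 : -κ - x ≠ 0 := by linarith
  have n2 : -κ - y ≠ 0 := by linarith
  have n3 : κ - x ≠ 0 := by linarith
  have n4 : κ - y ≠ 0 := by linarith
  have n5 : κ + x ≠ 0 := by linarith
  have n6 : κ + y ≠ 0 := by linarith
  have h : s - t = (x - y) * (((κ + x) * (κ + y))⁻¹ + ((κ - x) * (κ - y))⁻¹) := by
    rw [← es, ← et]
    unfold curvatureChart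
    have e1 : (-κ - x)⁻¹ = -(κ + x)⁻¹ := by rw [← neg_add', inv_neg]
    have e2 : (-κ - y)⁻¹ = -(κ + y)⁻¹ := by rw [← neg_add', inv_neg]
    rw [e1, e2]
    field_simp
    ring
  have b1 : (4 * κ ^ 2)⁻¹ ≤ ((κ + x) * (κ + y))⁻¹ := by
    apply inv_anti₀ h1
    nlinarith
  have b2 : (4 * κ ^ 2)⁻¹ ≤ ((κ - x) * (κ - y))⁻¹ := by
    apply inv_anti₀ h2
    nlinarith
  have b3 : 0 < (4 * κ ^ 2)⁻¹ := by positivity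
  rw [h, abs_mul, abs_of_pos (show 0 < ((κ + x) * (κ + y))⁻¹ + ((κ - x) * (κ - y))⁻¹ by linarith)]
  have b4 : 1 ≤ 2 * κ ^ 2 * (((κ + x) * (κ + y))⁻¹ + ((κ - x) * (κ - y))⁻¹) := by
    calc (1 : ℝ) = 2 * κ ^ 2 * ((4 * κ ^ 2)⁻¹ + (4 * κ ^ 2)⁻¹) := by field_simp; norm_num
      _ ≤ _ := by gcongr
  calc |x - y| = |x - y| * 1 := (mul_one _).symm
    _ ≤ |x - y| * (2 * κ ^ 2 * (((κ + x) * (κ + y))⁻¹ + ((κ - x) * (κ - y))⁻¹)) := by gcongr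
    _ = _ := by ring

theorem continuous_speedOf : Continuous speedOf :=
  (LipschitzWith.of_dist_le_mul (K := 1) fun s t => by
    simpa [Real.dist_eq] using abs_speedOf_sub_le s t).continuous

theorem continuous_curvatureOf {κ : ℝ} (hκ : 0 < κ) : Continuous (curvatureOf (-κ) κ) :=
  (LipschitzWith.of_dist_le_mul (K := ⟨2 * κ ^ 2, by positivity⟩) fun s t => by
    rw [Real.dist_eq, Real.dist_eq]
    exact abs_curvatureOf_sub_le hκ s t).continuous

/-! ### Products of primitives -/

/-- The product rule, in integrated form, for two absolutely continuous functions. -/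
theorem mul_eq_add_integral {f g φ ψ : ℝ → ℝ} (hφ : IntervalIntegrable φ volume 0 1)
    (hψ : IntervalIntegrable ψ volume 0 1)
    (hf : ∀ t ∈ Icc (0 : ℝ) 1, f t = f 0 + ∫ s in (0 : ℝ)..t, φ s)
    (hg : ∀ t ∈ Icc (0 : ℝ) 1, g t = g 0 + ∫ s in (0 : ℝ)..t, ψ s) {t : ℝ}
    (ht : t ∈ Icc (0 : ℝ) 1) :
    f t * g t = f 0 * g 0 + ∫ s in (0 : ℝ)..t, (φ s * g s + f s * ψ s) := by
  have hsub : uIcc 0 t ⊆ uIcc (0 : ℝ) 1 := by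
    rw [uIcc_of_le ht.1, uIcc_of_le zero_le_one]
    exact Icc_subset_Icc_right ht.2
  have hac : ∀ {φ : ℝ → ℝ} (C : ℝ), IntervalIntegrable φ volume 0 1 →
      AbsolutelyContinuousOnInterval (fun x => C + ∫ s in (0 : ℝ)..x, φ s) 0 t := by
    intro φ C hφ
    have h1 : AbsolutelyContinuousOnInterval (fun _ : ℝ => C) 0 t :=
      (LipschitzWith.const C).lipschitzOnWith.absolutelyContinuousOnInterval
    exact h1.fun_add ((hφ.absolutelyContinuousOnInterval_intervalIntegral
      (c := 0) (by simp)).mono hsub)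
  have h := (hac (f 0) hφ).integral_deriv_mul_eq_sub (hac (g 0) hψ)
  rw [← hf t ht, ← hg t ht, intervalIntegral.integral_same, intervalIntegral.integral_same,
    add_zero, add_zero] at h
  rw [eq_comm, ← eq_sub_iff_add_eq', ← h]
  refine intervalIntegral.integral_congr_ae ?_
  filter_upwards [hφ.ae_hasDerivAt_integral, hψ.ae_hasDerivAt_integral] with x h1 h2 hx
  have hx' : x ∈ uIcc (0 : ℝ) 1 := hsub (uIoc_subset_uIcc hx)
  have hx'' : x ∈ Icc (0 : ℝ) 1 := by rwa [uIcc_of_le zero_le_one] at hx'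
  rw [((h1 hx' 0 (by simp)).const_add (f 0)).deriv, ((h2 hx' 0 (by simp)).const_add (g 0)).deriv,
    ← hf x hx'', ← hg x hx'']

/-- A primitive on `[0, 1]` of a `1`-periodic function, with equal values at both ends, extends
periodically to a primitive on the line. -/
theorem fract_sub_eq_integral {f φ : ℝ → ℝ} (hφ : ∀ a b, IntervalIntegrable φ volume a b)
    (hper : Function.Periodic φ 1)
    (hf : ∀ t ∈ Icc (0 : ℝ) 1, f t = f 0 + ∫ s in (0 : ℝ)..t, φ s) (h1 : f 1 = f 0) (a b : ℝ) :
    f (Int.fract b) - f (Int.fract a) = ∫ s in a..b, φ s := by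
  have h0 : ∫ s in (0 : ℝ)..1, φ s = 0 := by
    have := hf 1 ⟨zero_le_one, le_rfl⟩
    linarith
  have key : ∀ b, f (Int.fract b) = f 0 + ∫ s in (0 : ℝ)..b, φ s := by
    intro b
    have e := hper.intervalIntegral_add_zsmul_eq ⌊b⌋ (Int.fract b) hφ
    rw [hper.intervalIntegral_add_eq _ 0, zero_add, h0, smul_zero, zsmul_one,
      Int.fract_add_floor] at e
    rw [hf _ ⟨Int.fract_nonneg b, (Int.fract_lt_one b).le⟩,
      ← intervalIntegral.integral_add_adjacent_intervals (hφ 0 (Int.fract b)) (hφ _ b), e, add_zero]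
  rw [key a, key b, ← intervalIntegral.integral_add_adjacent_intervals (hφ 0 a) (hφ a b)]
  ring

theorem integral_abs_mul_abs_le {f : ℝ → ℝ} (hf : MemLp f 2 (volume.restrict (Icc (0 : ℝ) 1)))
    (g : L2I) : ∫ t in Icc (0 : ℝ) 1, |f t| * |g t| ≤ ‖hf.toLp f‖ * ‖g‖ := by
  have h1 : ∫ t in Icc (0 : ℝ) 1, |f t| * |g t| = ⟪|hf.toLp f|, |g|⟫ := by
    rw [L2.inner_def]
    refine integral_congr_ae ?_
    filter_upwards [hf.coeFn_toLp, Lp.coeFn_abs (hf.toLp f), Lp.coeFn_abs g] with t h1 h2 h3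
    rw [h2, h3, h1]
    simp [mul_comm]
  rw [h1]
  refine (real_inner_le_norm _ _).trans ?_
  rw [norm_abs_eq_norm, norm_abs_eq_norm]

namespace AdmissibleCurve

variable {κ : ℝ}

/-! ### The frame of an admissible curve -/

/-- The speed of the curve. -/
noncomputable def speed (γ : AdmissibleCurve (-κ) κ) (t : ℝ) : ℝ := speedOf (γ.vhat t)

/-- The geodesic curvature of the curve. -/
noncomputable def curv (γ : AdmissibleCurve (-κ) κ) (t : ℝ) : ℝ := curvatureOf (-κ) κ (γ.what t)

/-- The entries of the frame as functions on the line, constant outside `[0, 1]`. -/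
noncomputable def entry (γ : AdmissibleCurve (-κ) κ) (i j : Fin 3) (t : ℝ) : ℝ :=
  IccExtend zero_le_one γ.frame t i j

theorem speed_pos (γ : AdmissibleCurve (-κ) κ) (t : ℝ) : 0 < γ.speed t := speedOf_pos _

theorem abs_curv_lt (hκ : 0 < κ) (γ : AdmissibleCurve (-κ) κ) (t : ℝ) : |γ.curv t| < κ :=
  abs_lt.2 (curvatureOf_mem (by linarith) _)

theorem continuous_entry (γ : AdmissibleCurve (-κ) κ) (i j : Fin 3) : Continuous (γ.entry i j) := by
  have : Continuous (IccExtend (zero_le_one (α := ℝ)) γ.frame) := γ.frame.continuous.Icc_extend'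
  exact (continuous_apply j).comp ((continuous_apply i).comp this)

theorem entry_eq (γ : AdmissibleCurve (-κ) κ) (i j : Fin 3) {t : ℝ} (ht : t ∈ Icc (0 : ℝ) 1) :
    γ.entry i j t = γ.frame ⟨t, ht⟩ i j := by
  rw [entry, IccExtend_of_mem _ _ ht]

theorem memLp_speed (γ : AdmissibleCurve (-κ) κ) :
    MemLp γ.speed 2 (volume.restrict (Icc (0 : ℝ) 1)) := by
  have h1 : MemLp (fun t => |γ.vhat t| + 1) 2 (volume.restrict (Icc (0 : ℝ) 1)) :=
    (Lp.memLp γ.vhat).abs.add (memLp_const 1)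
  refine h1.of_le (continuous_speedOf.comp_aestronglyMeasurable (Lp.aestronglyMeasurable γ.vhat))
    (Eventually.of_forall fun t => ?_)
  have h2 := abs_speedOf_sub_le (γ.vhat t) 0
  have h3 : speedOf 0 = 1 := by
    have : (4 : ℝ) = 2 ^ 2 := by norm_num
    rw [speedOf, zero_pow two_ne_zero, zero_add, zero_add, this, sqrt_sq (by norm_num)]
    norm_num
  rw [h3, sub_zero] at h2
  rw [Real.norm_eq_abs, Real.norm_eq_abs, speed, abs_of_pos (speedOf_pos _),
    abs_of_nonneg (by positivity)]
  linarith [le_abs_self (speedOf (γ.vhat t) - 1)]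

theorem integrableOn_speed (γ : AdmissibleCurve (-κ) κ) :
    IntegrableOn γ.speed (Icc (0 : ℝ) 1) :=
  γ.memLp_speed.integrable (by norm_num)

theorem aestronglyMeasurable_curv (hκ : 0 < κ) (γ : AdmissibleCurve (-κ) κ) :
    AEStronglyMeasurable γ.curv (volume.restrict (Icc (0 : ℝ) 1)) :=
  (continuous_curvatureOf hκ).comp_aestronglyMeasurable (Lp.aestronglyMeasurable γ.what)

theorem integrableOn_speed_mul_curv (hκ : 0 < κ) (γ : AdmissibleCurve (-κ) κ) :
    IntegrableOn (fun t => γ.speed t * γ.curv t) (Icc (0 : ℝ) 1) :=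
  γ.integrableOn_speed.mul_bdd (c := κ) (γ.aestronglyMeasurable_curv hκ)
    (Eventually.of_forall fun t => (γ.abs_curv_lt hκ t).le)

theorem intervalIntegrable_of_Icc {f : ℝ → ℝ} (h : IntegrableOn f (Icc (0 : ℝ) 1)) :
    IntervalIntegrable f volume 0 1 :=
  (intervalIntegrable_iff_integrableOn_Icc_of_le zero_le_one).2 h

theorem intervalIntegrable_speed (γ : AdmissibleCurve (-κ) κ) :
    IntervalIntegrable γ.speed volume 0 1 := intervalIntegrable_of_Icc γ.integrableOn_speed

theorem intervalIntegrable_speed_mul_curv (hκ : 0 < κ) (γ : AdmissibleCurve (-κ) κ) :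
    IntervalIntegrable (fun t => γ.speed t * γ.curv t) volume 0 1 :=
  intervalIntegrable_of_Icc (γ.integrableOn_speed_mul_curv hκ)

theorem entry_zero (γ : AdmissibleCurve (-κ) κ) (i j : Fin 3) :
    γ.entry i j 0 = (1 : Matrix (Fin 3) (Fin 3) ℝ) i j := by
  rw [entry_eq γ i j ⟨le_rfl, zero_le_one⟩, γ.frame_eq]
  simp

/-- The derivative of the entry `(i, j)` of the frame, for `j = 0, 1, 2`. -/
noncomputable def dEntry (γ : AdmissibleCurve (-κ) κ) (i j : Fin 3) (t : ℝ) : ℝ :=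
  ![γ.speed t * γ.entry i 1 t,
    -(γ.speed t * γ.entry i 0 t) + γ.speed t * γ.curv t * γ.entry i 2 t,
    -(γ.speed t * γ.curv t * γ.entry i 1 t)] j

theorem entry_eq_integral (γ : AdmissibleCurve (-κ) κ) (i j : Fin 3) {t : ℝ}
    (ht : t ∈ Icc (0 : ℝ) 1) :
    γ.entry i j t = γ.entry i j 0 + ∫ s in (0 : ℝ)..t, γ.dEntry i j s := by
  rw [entry_zero, entry_eq γ i j ht, γ.frame_eq]
  congr 1
  refine intervalIntegral.integral_congr fun s _ => ?_
  fin_cases j <;>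
    simp [Matrix.mul_apply, Fin.sum_univ_three, frameMatrix, dEntry, entry, speed, curv] <;> ring

theorem intervalIntegrable_dEntry (hκ : 0 < κ) (γ : AdmissibleCurve (-κ) κ) (i j : Fin 3) :
    IntervalIntegrable (γ.dEntry i j) volume 0 1 := by
  have hv := γ.intervalIntegrable_speed
  have hw := γ.intervalIntegrable_speed_mul_curv hκ
  have hc := fun j => (γ.continuous_entry i j).continuousOn (s := uIcc 0 1)
  fin_cases j
  · exact hv.mul_continuousOn (hc 1)
  · exact (hv.mul_continuousOn (hc 0)).neg.add (hw.mul_continuousOn (hc 2))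
  · exact (hw.mul_continuousOn (hc 1)).neg

/-- For two admissible curves, `(Φ Ψᵀ)' = Φ (Λ_Φ - Λ_Ψ) Ψᵀ`, because `Λ` is antisymmetric. -/
theorem sum_entry_mul_entry (hκ : 0 < κ) (γ γ' : AdmissibleCurve (-κ) κ) (i l : Fin 3) {t : ℝ}
    (ht : t ∈ Icc (0 : ℝ) 1) :
    ∑ j, γ.entry i j t * γ'.entry l j t = (1 : Matrix (Fin 3) (Fin 3) ℝ) i l +
      ∫ s in (0 : ℝ)..t, ((γ.speed s - γ'.speed s) *
          (γ.entry i 1 s * γ'.entry l 0 s - γ.entry i 0 s * γ'.entry l 1 s) +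
        (γ.speed s * γ.curv s - γ'.speed s * γ'.curv s) *
          (γ.entry i 2 s * γ'.entry l 1 s - γ.entry i 1 s * γ'.entry l 2 s)) := by
  have h := fun j => mul_eq_add_integral (γ.intervalIntegrable_dEntry hκ i j)
    (γ'.intervalIntegrable_dEntry hκ l j) (fun t ht => γ.entry_eq_integral i j ht)
    (fun t ht => γ'.entry_eq_integral l j ht) ht
  have hsub : uIcc 0 t ⊆ uIcc (0 : ℝ) 1 := by
    rw [uIcc_of_le ht.1, uIcc_of_le zero_le_one]
    exact Icc_subset_Icc_right ht.2
  have hint : ∀ j, IntervalIntegrable (fun s => γ.dEntry i j s * γ'.entry l j s +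
      γ.entry i j s * γ'.dEntry l j s) volume 0 t := fun j =>
    (((γ.intervalIntegrable_dEntry hκ i j).mono_set hsub).mul_continuousOn
      (γ'.continuous_entry l j).continuousOn).add
    (((γ'.intervalIntegrable_dEntry hκ l j).mono_set hsub).continuousOn_mul
      (γ.continuous_entry i j).continuousOn)
  rw [Finset.sum_congr rfl (fun j _ => h j), Finset.sum_add_distrib,
    ← intervalIntegral.integral_finsetSum (fun j _ => hint j)]
  congr 1
  · simp only [entry_zero]
    simp [Matrix.one_apply]
  · refine intervalIntegral.integral_congr fun s _ => ?_
    simp only [Fin.sum_univ_three, dEntry, Matrix.cons_val_zero, Matrix.cons_val_one,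
      Matrix.cons_val]
    ring

theorem frame_mul_transpose (hκ : 0 < κ) (γ : AdmissibleCurve (-κ) κ) (i l : Fin 3) {t : ℝ}
    (ht : t ∈ Icc (0 : ℝ) 1) :
    ∑ j, γ.entry i j t * γ.entry l j t = (1 : Matrix (Fin 3) (Fin 3) ℝ) i l := by
  rw [sum_entry_mul_entry hκ γ γ i l ht]
  simp

theorem transpose_mul_frame (hκ : 0 < κ) (γ : AdmissibleCurve (-κ) κ) (j k : Fin 3) {t : ℝ}
    (ht : t ∈ Icc (0 : ℝ) 1) :
    ∑ i, γ.entry i j t * γ.entry i k t = (1 : Matrix (Fin 3) (Fin 3) ℝ) j k := by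
  let A : Matrix (Fin 3) (Fin 3) ℝ := Matrix.of fun i j => γ.entry i j t
  have h : A * A.transpose = 1 := by
    ext i l
    rw [Matrix.mul_apply]
    exact γ.frame_mul_transpose hκ i l ht
  have h' := congrArg (fun M : Matrix (Fin 3) (Fin 3) ℝ => M j k) (mul_eq_one_comm.1 h)
  simp only [Matrix.mul_apply] at h'
  exact h'

theorem abs_entry_le (hκ : 0 < κ) (γ : AdmissibleCurve (-κ) κ) (i j : Fin 3) {t : ℝ}
    (ht : t ∈ Icc (0 : ℝ) 1) : |γ.entry i j t| ≤ 1 := by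
  have h := γ.transpose_mul_frame hκ j j ht
  rw [Matrix.one_apply_eq] at h
  have h1 : γ.entry i j t * γ.entry i j t ≤ 1 := by
    rw [← h]
    exact Finset.single_le_sum (f := fun i => γ.entry i j t * γ.entry i j t)
      (fun i _ => mul_self_nonneg _) (Finset.mem_univ i)
  exact abs_le_one_iff_mul_self_le_one.2 h1

/-- The `L¹` distance of the coefficients of the frame equations of two curves. -/
noncomputable def coeffDist (γ γ' : AdmissibleCurve (-κ) κ) : ℝ :=
  ∫ t in Icc (0 : ℝ) 1, (2 * |γ.speed t - γ'.speed t| +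
    2 * |γ.speed t * γ.curv t - γ'.speed t * γ'.curv t|)

theorem integrableOn_coeffDist (hκ : 0 < κ) (γ γ' : AdmissibleCurve (-κ) κ) :
    IntegrableOn (fun t => 2 * |γ.speed t - γ'.speed t| +
      2 * |γ.speed t * γ.curv t - γ'.speed t * γ'.curv t|) (Icc (0 : ℝ) 1) :=
  ((γ.integrableOn_speed.sub γ'.integrableOn_speed).abs.const_mul 2).add
    (((γ.integrableOn_speed_mul_curv hκ).sub
      (γ'.integrableOn_speed_mul_curv hκ)).abs.const_mul 2)

/-- The frame depends Lipschitz continuously, in the uniform norm, on the coefficients of the frame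
equations in the `L¹` norm. -/
theorem abs_entry_sub_le (hκ : 0 < κ) (γ γ' : AdmissibleCurve (-κ) κ) (i j : Fin 3) {t : ℝ}
    (ht : t ∈ Icc (0 : ℝ) 1) : |γ.entry i j t - γ'.entry i j t| ≤ 3 * coeffDist γ γ' := by
  have hG : ∀ l, |∑ j, γ.entry i j t * γ'.entry l j t - (1 : Matrix (Fin 3) (Fin 3) ℝ) i l| ≤
      coeffDist γ γ' := by
    intro l
    rw [sum_entry_mul_entry hκ γ γ' i l ht, add_sub_cancel_left, ← Real.norm_eq_abs]
    have hI := γ.integrableOn_coeffDist hκ γ'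
    have hI' : IntegrableOn (fun t => 2 * |γ.speed t - γ'.speed t| +
        2 * |γ.speed t * γ.curv t - γ'.speed t * γ'.curv t|) (Ioc 0 t) :=
      hI.mono_set (Ioc_subset_Icc_self.trans (Icc_subset_Icc_right ht.2))
    refine (intervalIntegral.norm_integral_le_of_norm_le ht.1
      (g := fun t => 2 * |γ.speed t - γ'.speed t| +
        2 * |γ.speed t * γ.curv t - γ'.speed t * γ'.curv t|)
      (Eventually.of_forall fun s hs => ?_) ?_).trans ?_
    · have hs' : s ∈ Icc (0 : ℝ) 1 := ⟨hs.1.le, hs.2.trans ht.2⟩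
      have hb : ∀ a b c d, |γ.entry i a s * γ'.entry l b s - γ.entry i c s * γ'.entry l d s| ≤ 2 := by
        intro a b c d
        refine (abs_sub _ _).trans ?_
        rw [abs_mul, abs_mul]
        have h1 := mul_le_one₀ (γ.abs_entry_le hκ i a hs') (abs_nonneg _)
          (γ'.abs_entry_le hκ l b hs')
        have h2 := mul_le_one₀ (γ.abs_entry_le hκ i c hs') (abs_nonneg _)
          (γ'.abs_entry_le hκ l d hs')
        linarith
      rw [Real.norm_eq_abs]
      refine (abs_add_le _ _).trans ?_
      rw [abs_mul, abs_mul, mul_comm 2, mul_comm 2]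
      gcongr <;> exact hb _ _ _ _
    · rw [intervalIntegrable_iff_integrableOn_Ioc_of_le ht.1]
      exact hI'
    · rw [intervalIntegral.integral_of_le ht.1]
      refine setIntegral_mono_set hI (Eventually.of_forall fun s => ?_)
        (Ioc_subset_Icc_self.trans (Icc_subset_Icc_right ht.2)).eventuallyLE
      simp only [Pi.zero_apply]
      positivity
  have e : γ.entry i j t - γ'.entry i j t =
      ∑ l, (∑ j, γ.entry i j t * γ'.entry l j t - (1 : Matrix (Fin 3) (Fin 3) ℝ) i l) *
        γ'.entry l j t := by
    have h1 : ∑ l, (1 : Matrix (Fin 3) (Fin 3) ℝ) i l * γ'.entry l j t = γ'.entry i j t := by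
      simp [Matrix.one_apply]
    have h2 : ∑ l, (∑ k, γ.entry i k t * γ'.entry l k t) * γ'.entry l j t = γ.entry i j t := by
      simp only [Finset.sum_mul]
      rw [Finset.sum_comm]
      have : ∀ k, ∑ l, γ.entry i k t * γ'.entry l k t * γ'.entry l j t =
          γ.entry i k t * (1 : Matrix (Fin 3) (Fin 3) ℝ) k j := fun k => by
        rw [← γ'.transpose_mul_frame hκ k j ht, Finset.mul_sum]
        exact Finset.sum_congr rfl fun l _ => mul_assoc _ _ _
      rw [Finset.sum_congr rfl fun k _ => this k]
      simp [Matrix.one_apply]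
    simp only [sub_mul, Finset.sum_sub_distrib]
    rw [h1, h2]
  rw [e]
  refine (Finset.abs_sum_le_sum_abs _ _).trans ?_
  have hb : ∀ l ∈ Finset.univ, |(∑ j, γ.entry i j t * γ'.entry l j t -
      (1 : Matrix (Fin 3) (Fin 3) ℝ) i l) * γ'.entry l j t| ≤ coeffDist γ γ' := by
    intro l _
    rw [abs_mul]
    have h0 := hG l
    have h1 := γ'.abs_entry_le hκ l j ht
    exact (mul_le_of_le_one_right (abs_nonneg _) h1).trans h0
  refine (Finset.sum_le_card_nsmul _ _ _ hb).trans ?_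
  simp

theorem coeffDist_le (hκ : 0 < κ) (γ γ' : AdmissibleCurve (-κ) κ) :
    coeffDist γ γ' ≤
      2 * (1 + κ) * (‖(memLp_const (1 : ℝ)).toLp (μ := volume.restrict (Icc (0 : ℝ) 1)) (p := 2)
        (fun _ => (1 : ℝ))‖ * ‖γ.vhat - γ'.vhat‖) +
      4 * κ ^ 2 * (‖γ'.memLp_speed.toLp γ'.speed‖ * ‖γ.what - γ'.what‖) := by
  have h1 := integral_abs_mul_abs_le (memLp_const (1 : ℝ)) (γ.vhat - γ'.vhat)
  have h2 := integral_abs_mul_abs_le γ'.memLp_speed (γ.what - γ'.what)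
  have hb : ∀ᵐ t ∂(volume.restrict (Icc (0 : ℝ) 1)), 2 * |γ.speed t - γ'.speed t| +
      2 * |γ.speed t * γ.curv t - γ'.speed t * γ'.curv t| ≤
      2 * (1 + κ) * (|(1 : ℝ)| * |(γ.vhat - γ'.vhat : L2I) t|) +
      4 * κ ^ 2 * (|γ'.speed t| * |(γ.what - γ'.what : L2I) t|) := by
    filter_upwards [Lp.coeFn_sub γ.vhat γ'.vhat, Lp.coeFn_sub γ.what γ'.what] with t e1 e2
    rw [e1, e2, abs_one, one_mul, Pi.sub_apply, Pi.sub_apply]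
    have b1 : |γ.speed t - γ'.speed t| ≤ |γ.vhat t - γ'.vhat t| := abs_speedOf_sub_le _ _
    have b2 : |γ.curv t - γ'.curv t| ≤ 2 * κ ^ 2 * |γ.what t - γ'.what t| :=
      abs_curvatureOf_sub_le hκ _ _
    have b3 : γ.speed t * γ.curv t - γ'.speed t * γ'.curv t =
      (γ.speed t - γ'.speed t) * γ.curv t + γ'.speed t * (γ.curv t - γ'.curv t) := by ring
    have b4 : |γ.speed t * γ.curv t - γ'.speed t * γ'.curv t| ≤
        |γ.vhat t - γ'.vhat t| * κ + |γ'.speed t| * (2 * κ ^ 2 * |γ.what t - γ'.what t|) := by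
      rw [b3]
      refine (abs_add_le _ _).trans ?_
      rw [abs_mul, abs_mul]
      have := (γ.abs_curv_lt hκ t).le
      gcongr
    linarith
  have i1 : IntegrableOn (fun t => |(1 : ℝ)| * |(γ.vhat - γ'.vhat : L2I) t|) (Icc (0 : ℝ) 1) :=
    (((Lp.memLp (γ.vhat - γ'.vhat)).integrable (by norm_num)).abs.const_mul _)
  have i2 : IntegrableOn (fun t => |γ'.speed t| * |(γ.what - γ'.what : L2I) t|) (Icc (0 : ℝ) 1) :=
    γ'.memLp_speed.abs.integrable_mul (Lp.memLp (γ.what - γ'.what)).abs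
  refine (integral_mono_ae (γ.integrableOn_coeffDist hκ γ')
    ((i1.const_mul _).add (i2.const_mul _)) hb).trans ?_
  simp only [Pi.add_apply]
  rw [integral_add (i1.const_mul _) (i2.const_mul _)]
  refine add_le_add ?_ ?_
  · rw [integral_const_mul]
    exact mul_le_mul_of_nonneg_left h1 (by positivity)
  · rw [integral_const_mul]
    exact mul_le_mul_of_nonneg_left h2 (by positivity)

theorem eventually_coeffDist_lt (hκ : 0 < κ) (γ' : AdmissibleCurve (-κ) κ) {ε : ℝ} (hε : 0 < ε) :
    ∀ᶠ γ in 𝓝 γ', coeffDist γ γ' < ε := by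
  have hpair : Continuous fun γ : AdmissibleCurve (-κ) κ => (γ.vhat, γ.what) :=
    continuous_induced_dom
  have hv : Continuous fun γ : AdmissibleCurve (-κ) κ => γ.vhat := hpair.fst
  have hw : Continuous fun γ : AdmissibleCurve (-κ) κ => γ.what := hpair.snd
  have hB : Continuous fun γ : AdmissibleCurve (-κ) κ =>
      2 * (1 + κ) * (‖(memLp_const (1 : ℝ)).toLp (μ := volume.restrict (Icc (0 : ℝ) 1)) (p := 2)
        (fun _ => (1 : ℝ))‖ * ‖γ.vhat - γ'.vhat‖) +
      4 * κ ^ 2 * (‖γ'.memLp_speed.toLp γ'.speed‖ * ‖γ.what - γ'.what‖) :=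
    (continuous_const.mul (continuous_const.mul (hv.sub continuous_const).norm)).add
      (continuous_const.mul (continuous_const.mul (hw.sub continuous_const).norm))
  have h := hB.continuousAt (x := γ')
  simp only [ContinuousAt, sub_self, norm_zero, mul_zero, add_zero] at h
  filter_upwards [h.eventually_lt_const hε] with γ hγ
  exact (coeffDist_le hκ γ γ').trans_lt hγ

end AdmissibleCurve

namespace AdmissibleCurve

variable {κ : ℝ}

/-! ### Closed curves as framed loops -/

theorem periodicFrame_eq (γ : AdmissibleCurve (-κ) κ) (t : ℝ) (i j : Fin 3) :
    γ.periodicFrame t i j = γ.entry i j (Int.fract t) := by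
  rw [entry_eq γ i j ⟨Int.fract_nonneg t, (Int.fract_lt_one t).le⟩, periodicFrame]

/-- The columns of the periodic frame, as vectors of Euclidean space. -/
noncomputable def column (γ : AdmissibleCurve (-κ) κ) (j : Fin 3) (t : ℝ) :
    EuclideanSpace ℝ (Fin 3) :=
  WithLp.toLp 2 fun i => γ.entry i j (Int.fract t)

theorem inner_eq_sum (x y : EuclideanSpace ℝ (Fin 3)) : ⟪x, y⟫ = ∑ i, x i * y i := by
  rw [PiLp.inner_apply]
  exact Finset.sum_congr rfl fun i _ => by simp [mul_comm]

theorem inner_column (hκ : 0 < κ) (γ : AdmissibleCurve (-κ) κ) (j k : Fin 3) (t : ℝ) :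
    ⟪γ.column j t, γ.column k t⟫ = (1 : Matrix (Fin 3) (Fin 3) ℝ) j k := by
  rw [inner_eq_sum]
  exact γ.transpose_mul_frame hκ j k ⟨Int.fract_nonneg t, (Int.fract_lt_one t).le⟩

theorem norm_column (hκ : 0 < κ) (γ : AdmissibleCurve (-κ) κ) (j : Fin 3) (t : ℝ) :
    ‖γ.column j t‖ = 1 := by
  have h := γ.inner_column hκ j j t
  rw [real_inner_self_eq_norm_sq, Matrix.one_apply_eq] at h
  nlinarith [norm_nonneg (γ.column j t)]

theorem sum_inner_column_sq (hκ : 0 < κ) (γ : AdmissibleCurve (-κ) κ) (t : ℝ)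
    (x : EuclideanSpace ℝ (Fin 3)) :
    ⟪γ.column 0 t, x⟫ ^ 2 + ⟪γ.column 1 t, x⟫ ^ 2 + ⟪γ.column 2 t, x⟫ ^ 2 = ‖x‖ ^ 2 := by
  have h := fun i l => γ.frame_mul_transpose hκ i l
    (t := Int.fract t) ⟨Int.fract_nonneg t, (Int.fract_lt_one t).le⟩
  rw [← real_inner_self_eq_norm_sq]
  simp only [inner_eq_sum, column, Fin.sum_univ_three] at h ⊢
  have h00 := h 0 0
  have h01 := h 0 1
  have h02 := h 0 2
  have h11 := h 1 1
  have h12 := h 1 2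
  have h22 := h 2 2
  simp only [Matrix.one_apply, Fin.reduceEq, if_true, if_false] at h00 h01 h02 h11 h12 h22
  linear_combination x 0 ^ 2 * h00 + x 1 ^ 2 * h11 + x 2 ^ 2 * h22 + 2 * x 0 * x 1 * h01 +
    2 * x 0 * x 2 * h02 + 2 * x 1 * x 2 * h12

theorem entry_one (γ : AdmissibleCurve (-κ) κ) (h : γ ∈ closedCurves (-κ) κ) (i j : Fin 3) :
    γ.entry i j 1 = γ.entry i j 0 := by
  rw [entry_zero, entry_eq γ i j ⟨zero_le_one, le_rfl⟩]
  exact congrArg (fun M : Matrix (Fin 3) (Fin 3) ℝ => M i j) h.2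

theorem continuous_column (γ : AdmissibleCurve (-κ) κ) (h : γ ∈ closedCurves (-κ) κ)
    (j : Fin 3) : Continuous (γ.column j) := by
  refine (PiLp.continuous_toLp 2 _).comp (continuous_pi fun i => ?_)
  exact (γ.continuous_entry i j).continuousOn.comp_fract'' (γ.entry_one h i j).symm

theorem periodic_column (γ : AdmissibleCurve (-κ) κ) (j : Fin 3) :
    Function.Periodic (γ.column j) 1 := fun t => by
  simp only [column, Int.fract_add_one]

theorem periodic_comp_fract (f : ℝ → ℝ) : Function.Periodic (fun t => f (Int.fract t)) 1 :=
  fun t => by simp only [Int.fract_add_one]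

theorem comp_fract_ae_eq (f : ℝ → ℝ) {t : ℝ} (ht : t ∈ Icc (0 : ℝ) 1) :
    ∀ᵐ s, s ∈ uIoc 0 t → f s = f (Int.fract s) := by
  have h1 : ∀ᵐ s : ℝ, s ≠ 1 := by simp [ae_iff, measure_singleton]
  filter_upwards [h1] with s hs hst
  rw [uIoc_of_le ht.1] at hst
  rw [Int.fract_eq_self.2 ⟨hst.1.le, lt_of_le_of_ne (hst.2.trans ht.2) hs⟩]

theorem intervalIntegrable_comp_fract {f : ℝ → ℝ} (hf : IntervalIntegrable f volume 0 1)
    (a b : ℝ) : IntervalIntegrable (fun t => f (Int.fract t)) volume a b := by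
  have h : IntervalIntegrable (fun t => f (Int.fract t)) volume 0 1 := by
    refine hf.congr_ae ?_
    rw [EventuallyEq, ae_restrict_iff' measurableSet_uIoc]
    exact comp_fract_ae_eq f ⟨zero_le_one, le_rfl⟩
  exact (periodic_comp_fract f).intervalIntegrable₀ one_ne_zero h a b

theorem entry_fract_sub (hκ : 0 < κ) (γ : AdmissibleCurve (-κ) κ)
    (h : γ ∈ closedCurves (-κ) κ) (i j : Fin 3) (a b : ℝ) :
    γ.entry i j (Int.fract b) - γ.entry i j (Int.fract a) =
      ∫ s in a..b, γ.dEntry i j (Int.fract s) := by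
  refine fract_sub_eq_integral
    (intervalIntegrable_comp_fract (γ.intervalIntegrable_dEntry hκ i j)) (periodic_comp_fract _)
    (fun t ht => ?_) (γ.entry_one h i j) a b
  rw [γ.entry_eq_integral i j ht, intervalIntegral.integral_congr_ae (comp_fract_ae_eq _ ht)]

theorem inner_column_sub (hκ : 0 < κ) (γ : AdmissibleCurve (-κ) κ)
    (h : γ ∈ closedCurves (-κ) κ) (j : Fin 3) (m : EuclideanSpace ℝ (Fin 3)) (a b : ℝ) :
    ⟪γ.column j b, m⟫ - ⟪γ.column j a, m⟫ =
      ∫ s in a..b, ∑ i, γ.dEntry i j (Int.fract s) * m i := by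
  rw [intervalIntegral.integral_finsetSum (fun i _ =>
    (intervalIntegrable_comp_fract (γ.intervalIntegrable_dEntry hκ i j) a b).mul_const (m i)),
    inner_eq_sum, inner_eq_sum, ← Finset.sum_sub_distrib]
  refine Finset.sum_congr rfl fun i _ => ?_
  rw [intervalIntegral.integral_mul_const, ← γ.entry_fract_sub hκ h, ← sub_mul]
  rfl

/-- A closed admissible curve, extended periodically, as a framed loop in Euclidean space. -/
noncomputable def toLoop (hκ : 0 < κ) (γ : AdmissibleCurve (-κ) κ)
    (h : γ ∈ closedCurves (-κ) κ) : FramedLoop κ (EuclideanSpace ℝ (Fin 3)) where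
  X := γ.column 0
  T := γ.column 1
  N := γ.column 2
  v t := γ.speed (Int.fract t)
  k t := γ.curv (Int.fract t)
  continuous_X := γ.continuous_column h 0
  continuous_T := γ.continuous_column h 1
  continuous_N := γ.continuous_column h 2
  periodic_X := γ.periodic_column 0
  periodic_T := γ.periodic_column 1
  periodic_N := γ.periodic_column 2
  v_pos t := γ.speed_pos _
  abs_k_lt t := γ.abs_curv_lt hκ _
  parseval := γ.sum_inner_column_sq hκ
  norm_X := γ.norm_column hκ 0
  norm_T := γ.norm_column hκ 1
  norm_N := γ.norm_column hκ 2
  inner_X_T t := by rw [γ.inner_column hκ]; simp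
  inner_X_N t := by rw [γ.inner_column hκ]; simp
  inner_T_N t := by rw [γ.inner_column hκ]; simp
  integrable_v := intervalIntegrable_comp_fract γ.intervalIntegrable_speed
  integrable_vk := intervalIntegrable_comp_fract (γ.intervalIntegrable_speed_mul_curv hκ)
  X_sub m a b := by
    rw [γ.inner_column_sub hκ h]
    refine intervalIntegral.integral_congr fun s _ => ?_
    simp only [inner_eq_sum, Fin.sum_univ_three, dEntry, column, Matrix.cons_val_zero]
    ring
  T_sub m a b := by
    rw [γ.inner_column_sub hκ h]
    refine intervalIntegral.integral_congr fun s _ => ?_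
    simp only [inner_eq_sum, Fin.sum_univ_three, dEntry, column, Matrix.cons_val_one,
      Matrix.cons_val_zero]
    ring
  N_sub m a b := by
    rw [γ.inner_column_sub hκ h]
    refine intervalIntegral.integral_congr fun s _ => ?_
    simp only [inner_eq_sum, Fin.sum_univ_three, dEntry, column, Matrix.cons_val]
    ring

theorem toLoop_band (hκ : 0 < κ) (γ : AdmissibleCurve (-κ) κ) (h : γ ∈ closedCurves (-κ) κ)
    (t θ : ℝ) : (γ.toLoop hκ h).band t θ = WithLp.toLp 2 (γ.band (t, θ)) := by
  ext i
  simp [FramedLoop.band, toLoop, column, band, curve, normal, periodicFrame_eq]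

theorem simple_toLoop (hκ : 0 < κ) (γ : AdmissibleCurve (-κ) κ) (h : γ ∈ closedCurves (-κ) κ)
    (r : ℝ) : (γ.toLoop hκ h).Simple r ↔ γ.BandSimple (-r) r := by
  simp only [FramedLoop.Simple, BandSimple, InjOn, toLoop_band, WithLp.toLp_injective _ |>.eq_iff]

theorem toLoop_X_add_half (hκ : 0 < κ) (γ : AdmissibleCurve (-κ) κ) (h : γ ∈ antipodalCurves κ)
    (t : ℝ) : (γ.toLoop hκ h.1).X (t + 1 / 2) = -(γ.toLoop hκ h.1).X t := by
  ext i
  have := congrFun (h.2 t) i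
  simp only [curve, periodicFrame_eq, Pi.neg_apply] at this
  simpa [toLoop, column] using this

theorem norm_column_sub_le (hκ : 0 < κ) (γ γ' : AdmissibleCurve (-κ) κ) (j : Fin 3) (t : ℝ) :
    ‖γ.column j t - γ'.column j t‖ ≤ 9 * coeffDist γ γ' := by
  have ht : Int.fract t ∈ Icc (0 : ℝ) 1 := ⟨Int.fract_nonneg t, (Int.fract_lt_one t).le⟩
  have h := fun i => γ.abs_entry_sub_le hκ γ' i j ht
  have h0 : 0 ≤ coeffDist γ γ' := by linarith [abs_nonneg _ |>.trans (h 0)]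
  have hs : ∀ i, (γ.entry i j (Int.fract t) - γ'.entry i j (Int.fract t)) ^ 2 ≤
      (3 * coeffDist γ γ') ^ 2 := fun i => by
    rw [← sq_abs]
    exact pow_le_pow_left₀ (abs_nonneg _) (h i) 2
  refine le_of_sq_le_sq ?_ (by positivity)
  rw [EuclideanSpace.real_norm_sq_eq, Fin.sum_univ_three]
  simp only [column, PiLp.sub_apply]
  nlinarith [hs 0, hs 1, hs 2, sq_nonneg (coeffDist γ γ')]

theorem eventually_norm_sub_lt (hκ : 0 < κ) (γ' : AdmissibleCurve (-κ) κ) {ε : ℝ} (hε : 0 < ε) :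
    ∀ᶠ γ in 𝓝 γ', ∀ j t, ‖γ.column j t - γ'.column j t‖ < ε := by
  filter_upwards [γ'.eventually_coeffDist_lt hκ (show 0 < ε / 9 by positivity)] with γ hγ j t
  refine (norm_column_sub_le hκ γ γ' j t).trans_lt ?_
  linarith

/-! ### Multiply covered equators -/

/-- The rotation about the third axis by the angle `a`. -/
noncomputable def rotation (a : ℝ) : Matrix (Fin 3) (Fin 3) ℝ :=
  !![cos a, -sin a, 0;
     sin a, cos a, 0;
     0, 0, 1]

theorem hasDerivAt_rotation (a s : ℝ) (i j : Fin 3) :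
    HasDerivAt (fun s => rotation (a * s) i j) ((rotation (a * s) * frameMatrix a 0) i j) s := by
  have h0 : HasDerivAt (fun s => a * s) a s := by simpa using (hasDerivAt_id s).const_mul a
  have hc := h0.cos
  have hs := h0.sin
  fin_cases i <;> fin_cases j <;>
    simp [rotation, frameMatrix, Matrix.mul_apply, Fin.sum_univ_three, hasDerivAt_const]
  · simpa using hc
  · simpa using hs.fun_neg
  · simpa using hs
  · simpa using hc

theorem continuous_rotation (a : ℝ) : Continuous fun s => rotation (a * s) := by
  refine continuous_matrix fun i j => ?_
  fin_cases i <;> fin_cases j <;> simp [rotation] <;> fun_prop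

/-- The equator traversed with constant speed `a > 0`. -/
noncomputable def equator (κ : ℝ) {a : ℝ} (ha : 0 < a) : AdmissibleCurve (-κ) κ where
  vhat := (memLp_const (speedChart a)).toLp _
  what := 0
  frame := ⟨fun t => rotation (a * t), (continuous_rotation a).comp continuous_subtype_val⟩
  frame_eq t i j := by
    have hv := (memLp_const (μ := volume.restrict (Icc (0 : ℝ) 1)) (p := 2)
      (speedChart a)).coeFn_toLp
    have hw := Lp.coeFn_zero ℝ 2 (volume.restrict (Icc (0 : ℝ) 1))
    rw [EventuallyEq, ae_restrict_iff' measurableSet_Icc] at hv hw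
    have hk : curvatureOf (-κ) κ 0 = 0 := by simp [curvatureOf]
    have hint : ∫ s in (0 : ℝ)..t, (rotation (a * s) * frameMatrix a 0) i j =
        rotation (a * t) i j - rotation (a * 0) i j := by
      refine intervalIntegral.integral_eq_sub_of_hasDerivAt
        (fun s _ => hasDerivAt_rotation a s i j) ?_
      refine Continuous.intervalIntegrable ?_ _ _
      exact ((continuous_rotation a).matrix_mul continuous_const).matrix_elem i j
    have h1 : rotation (a * 0) = 1 := by
      ext i j
      fin_cases i <;> fin_cases j <;> simp [rotation]
    rw [h1] at hint
    rw [eq_comm, ← eq_sub_iff_add_eq']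
    refine Eq.trans ?_ hint
    refine intervalIntegral.integral_congr_ae ?_
    filter_upwards [hv, hw] with s hv hw hs
    rw [uIoc_of_le t.2.1] at hs
    have hs' : s ∈ Icc (0 : ℝ) 1 := ⟨hs.1.le, hs.2.trans t.2.2⟩
    rw [hv hs', hw hs', Pi.zero_apply, hk, mul_zero, speedOf_speedChart ha,
      IccExtend_of_mem _ _ hs']
    rfl

theorem equator_periodicFrame (κ : ℝ) {a : ℝ} (ha : 0 < a) (t : ℝ) :
    (equator κ ha).periodicFrame t = rotation (a * Int.fract t) := rfl

theorem sigma_speed_pos (m : ℕ) : 0 < (2 * (m : ℝ) + 1) * (2 * π) := by positivity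

theorem rotation_fract (m : ℕ) (t : ℝ) :
    rotation ((2 * (m : ℝ) + 1) * (2 * π) * Int.fract t) =
      rotation ((2 * (m : ℝ) + 1) * (2 * π * t)) := by
  have e : (2 * (m : ℝ) + 1) * (2 * π) * Int.fract t = (2 * (m : ℝ) + 1) * (2 * π * t) -
      (((2 * m + 1) * ⌊t⌋ : ℤ) : ℝ) * (2 * π) := by
    rw [Int.fract]; push_cast; ring
  simp only [rotation]
  rw [e, cos_sub_int_mul_two_pi, sin_sub_int_mul_two_pi]

theorem equator_curve (κ : ℝ) (m : ℕ) : (equator κ (sigma_speed_pos m)).curve = sigma m := by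
  ext t i
  rw [curve, equator_periodicFrame, rotation_fract]
  fin_cases i <;> simp [rotation, sigma]

theorem equator_mem_antipodalCurves (κ : ℝ) (m : ℕ) :
    equator κ (sigma_speed_pos m) ∈ antipodalCurves κ := by
  refine ⟨⟨?_, ?_⟩, fun t => ?_⟩
  · change rotation ((2 * (m : ℝ) + 1) * (2 * π) * (0 : ℝ)) = 1
    ext i j
    fin_cases i <;> fin_cases j <;> simp [rotation]
  · change rotation ((2 * (m : ℝ) + 1) * (2 * π) * (1 : ℝ)) = 1
    have e : (2 * (m : ℝ) + 1) * (2 * π) * (1 : ℝ) = ((2 * m + 1 : ℤ) : ℝ) * (2 * π) := by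
      push_cast; ring
    rw [e, rotation, cos_int_mul_two_pi, ← zero_add (((2 * m + 1 : ℤ) : ℝ) * (2 * π)),
      sin_add_int_mul_two_pi, sin_zero]
    ext i j
    fin_cases i <;> fin_cases j <;> simp
  · rw [equator_curve]
    have e : (2 * (m : ℝ) + 1) * (2 * π * (t + 1 / 2)) =
        (2 * (m : ℝ) + 1) * (2 * π * t) + π + (m : ℤ) * (2 * π) := by
      push_cast; ring
    ext i
    simp only [sigma]
    rw [e, cos_add_int_mul_two_pi, sin_add_int_mul_two_pi, cos_add_pi, sin_add_pi]
    fin_cases i <;> simp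

/-- The simply covered equator has a simple band, given by geographical coordinates. -/
theorem equator_bandSimple (κ : ℝ) {r : ℝ} (hr : r < π / 2) :
    (equator κ (sigma_speed_pos 0)).BandSimple (-r) r := by
  rintro ⟨t, θ⟩ ⟨ht, hθ⟩ ⟨s, φ⟩ ⟨hs, hφ⟩ heq
  simp only at ht hs hθ hφ
  simp only [band, equator_curve] at heq
  have h0 := congrFun heq 0
  have h1 := congrFun heq 1
  have h2 := congrFun heq 2
  simp [sigma, normal, equator_periodicFrame, rotation] at h0 h1 h2
  have hθφ : θ = φ := injOn_sin ⟨by linarith [hθ.1], by linarith [hθ.2]⟩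
    ⟨by linarith [hφ.1], by linarith [hφ.2]⟩ h2
  subst hθφ
  have hc : cos θ ≠ 0 := (cos_pos_of_mem_Ioo ⟨by linarith [hθ.1], by linarith [hθ.2]⟩).ne'
  have hcos : cos (2 * π * t) = cos (2 * π * s) := by simpa [hc] using h0
  have hsin : sin (2 * π * t) = sin (2 * π * s) := by simpa [hc] using h1
  have hang : ((2 * π * t : ℝ) : Real.Angle) = ((2 * π * s : ℝ) : Real.Angle) :=
    Real.Angle.cos_sin_inj hcos hsin
  obtain ⟨k, hk⟩ := Real.Angle.angle_eq_iff_two_pi_dvd_sub.1 hang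
  have hk' : t - s = k := by
    have : 2 * π * (t - s - k) = 0 := by linarith
    have := (mul_eq_zero.1 this).resolve_left (by positivity)
    linarith
  have k1 : (k : ℝ) < 1 := by linarith [ht.2, hs.1]
  have k2 : (-1 : ℝ) < k := by linarith [ht.1, hs.2]
  have k3 : k < 1 := by exact_mod_cast k1
  have k4 : -1 < k := by exact_mod_cast k2
  obtain rfl : k = 0 := by omega
  rw [Int.cast_zero, sub_eq_zero] at hk'
  rw [hk']

/-- The fivefold equator returns to its starting point at time `1 / 5`. -/
theorem not_bandSimple_of_curve_eq {γ : AdmissibleCurve (-κ) κ} {r : ℝ} (hr : 0 ≤ r)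
    (h : γ.curve = sigma 2) : ¬ γ.BandSimple (-r) r := by
  intro hinj
  have h0 : (0 : ℝ) ∈ Icc (-r) r := ⟨by linarith, hr⟩
  have e : (2 * ((2 : ℕ) : ℝ) + 1) * (2 * π * (1 / 5)) = 2 * π := by push_cast; ring
  have heq : γ.band (0, 0) = γ.band (1 / 5, 0) := by
    simp only [band, h, sigma]
    rw [e]
    simp
  have := @hinj (0, 0) ⟨⟨le_rfl, one_pos⟩, h0⟩ (1 / 5, 0) ⟨by norm_num, h0⟩ heq
  norm_num at this

end AdmissibleCurve

theorem mul_sin_le_cos_of_le_arccot {κ r : ℝ} (hr0 : 0 < r) (hr : r ≤ arccot κ)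
    (hr2 : r < π / 2) : κ * sin r ≤ cos r := by
  have h1 : arctan κ ≤ π / 2 - r := by unfold arccot at hr; linarith
  have h2 : κ ≤ tan (π / 2 - r) := by
    rw [← tan_arctan κ]
    exact strictMonoOn_tan.monotoneOn (arctan_mem_Ioo κ) ⟨by linarith, by linarith⟩ h1
  rw [tan_pi_div_two_sub, tan_eq_sin_div_cos, inv_div] at h2
  have hs : 0 < sin r := sin_pos_of_pos_of_lt_pi hr0 (by linarith)
  rwa [le_div_iff₀ hs] at h2

end BandCurves

open BandCurves BandCurves.AdmissibleCurve Filter Topology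

theorem mainTheorem12 (κ : ℝ) (hκ : 0 < κ) (hκ' : κ ≤ √3)
    (r : ℝ) (hr : r ∈ Set.Icc (Real.pi / 6) (BandCurves.arccot κ)) :
    (∃ γ ∈ BandCurves.simpleAntipodalCurves κ r, γ.curve = BandCurves.sigma 0) ∧
    (∃ γ ∈ BandCurves.antipodalCurves κ, γ.curve = BandCurves.sigma 2) ∧
    (∀ γ ∈ BandCurves.simpleAntipodalCurves κ r, γ.curve ≠ BandCurves.sigma 2) ∧
    IsOpen {γ : BandCurves.antipodalCurves κ | γ.1 ∈ BandCurves.simpleAntipodalCurves κ r} ∧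
    IsClosed {γ : BandCurves.antipodalCurves κ | γ.1 ∈ BandCurves.simpleAntipodalCurves κ r} := by
  have hr0 : 0 < r := by linarith [hr.1, pi_pos]
  have hr2 : r < π / 2 := by
    have h1 : 0 < arctan κ := arctan_pos.2 hκ
    have h2 := hr.2
    unfold arccot at h2
    linarith
  have hcot := mul_sin_le_cos_of_le_arccot hr0 hr.2 hr2
  have hiff : ∀ γ : antipodalCurves κ, γ.1 ∈ simpleAntipodalCurves κ r ↔
      (γ.1.toLoop hκ γ.2.1).Simple r := fun γ => by
    rw [simple_toLoop]
    exact and_iff_right γ.2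
  have hnear : ∀ (γ' : antipodalCurves κ) {ε : ℝ}, 0 < ε → ∀ᶠ γ : antipodalCurves κ in 𝓝 γ',
      ∀ j t, ‖γ.1.column j t - γ'.1.column j t‖ < ε := fun γ' ε hε =>
    continuous_subtype_val.continuousAt.eventually (γ'.1.eventually_norm_sub_lt hκ hε)
  refine ⟨⟨_, ⟨equator_mem_antipodalCurves κ 0, equator_bandSimple κ hr2⟩, equator_curve κ 0⟩,
    ⟨_, equator_mem_antipodalCurves κ 2, equator_curve κ 2⟩,
    fun γ hγ h => not_bandSimple_of_curve_eq hr0.le h hγ.2, ?_, ?_⟩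
  · rw [isOpen_iff_mem_nhds]
    intro γ' hγ'
    obtain ⟨ε, hε, h⟩ := ((hiff γ').1 hγ').exists_stable hr0 hr2 hcot
    filter_upwards [hnear γ' hε] with γ hγ
    exact (hiff γ).2 (h (γ.1.toLoop hκ γ.2.1) (fun t => hγ 0 t) (fun t => hγ 1 t)
      (fun t => hγ 2 t))
  · rw [← isOpen_compl_iff, isOpen_iff_mem_nhds]
    intro γ' hγ'
    have h1 := FramedLoop.twoPeaks_of_not_simple hr.1 hr2 hcot (γ'.1.toLoop_X_add_half hκ γ'.2)
      (fun h => hγ' ((hiff γ').2 h))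
    obtain ⟨ε, hε, h⟩ := h1.exists_stable
    filter_upwards [hnear γ' hε] with γ hγ hmem
    exact FramedLoop.not_simple_of_twoPeaks _ hr0 hr2 
      (h (γ.1.toLoop hκ γ.2.1) (fun t => hγ 0 t)) ((hiff γ).1 hmem)
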